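/- **Theorem 1.1.** Let $\Gamma$ be a finite metric tree: a finite connected graph without cycles whose edges $\gamma_1,\dots,\gamma_I$ have arbitrary lengths $a_1,\dots,a_I\in(0,\infty)$ (the ratios of the lengths need not be rational). Fix a vertex $v_0$ as root and identify each edge $\gamma_i$ with the interval $[0,a_i]$ so that $0$ corresponds to the endpoint further from $v_0$ and $a_i$ to the endpoint closer to $v_0$. Let $Q=(q_1,\dots,q_I)$ with $q_i\in L^1(0,a_i)$ real-valued. A real number $\lambda$ is called an eigenvalue if there are functions $y_i:[0,a_i]\to\mathbb R$ ($i=1,\dots,I$), not all identically zero, with $y_i$ continuously differentiable and $y_i'$ absolutely continuous on $[0,a_i]$, such that $$-y_i''+q_i y_i=\lambda y_i\quad\text{a.e. on }(0,a_i),\qquad i=1,\dots,I,$$ and such that at every vertex $v$ the following hold: - (continuity) the values at $v$ of all the functions $y_i$ on edges incident to $v$ coincide; - (Kirchhoff condition) $\displaystyle\sum_{i} y_i'(a_i)=\sum_{k} y_k'(0)$, where $i$ runs over the edges whose endpoint $a_i$ is $v$ and $k$ over the edges whose endpoint $0$ is $v$ (an empty sum is $0$). At a pendant vertex these conditions reduce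 to the Neumann condition, i.e. the derivative of the function on the single incident edge vanishes at that vertex. Let $\sigma(Q)$ be the set of all eigenvalues, and $\sigma(\mathbf 0)$ the set of eigenvalues for the zero potential $q_1=\dots=q_I=0$. If $\sigma(Q)=\sigma(\mathbf 0)$, then $q_i=0$ almost everywhere on $[0,a_i]$ for every $i=1,\dots,I$. -/

import Mathlib

open MeasureTheory Set

/-- A finite metric tree with a chosen root. The vertices are the elements of `V`, the edges are
labelled by `E`, and the edge `e` is identified with the interval `[0, len e]` so that the
coordinate `0` is the endpoint further from the root and `len e` is the endpoint closer to it. -/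
structure RootedMetricTree (V E : Type*) where
  graph : SimpleGraph V
  isTree : graph.IsTree
  root : V
  /-- The edge of the combinatorial tree that carries a given label. -/
  edge : E ≃ graph.edgeSet
  /-- The endpoint with local coordinate `0`. -/
  far : E → V
  /-- The endpoint with local coordinate `len e`. -/
  near : E → V
  edge_eq : ∀ e, (edge e : Sym2 V) = s(far e, near e)
  dist_far : ∀ e, graph.dist root (far e) = graph.dist root (near e) + 1
  len : E → ℝ
  len_pos : ∀ e, 0 < len e

/-- `y` is a solution of `-y'' + q y = lam y` on `[0, a]` with derivative `dy`, in the usual sense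
for an integrable potential: `y` is differentiable up to the endpoints, `y' = dy` is absolutely
continuous, and the equation holds almost everywhere. -/
structure IsSturmLiouvilleSolution (a : ℝ) (q : ℝ → ℝ) (lam : ℝ) (y dy : ℝ → ℝ) : Prop where
  hasDerivWithinAt : ∀ x ∈ Icc 0 a, HasDerivWithinAt y (dy x) (Icc 0 a) x
  absolutelyContinuous : AbsolutelyContinuousOnInterval dy 0 a
  equation : ∀ᵐ x ∂(volume.restrict (Ioo 0 a)),
    DifferentiableAt ℝ dy x ∧ -(deriv dy x) + q x * y x = lam * y x

namespace RootedMetricTree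

variable {V E : Type*} [Fintype E] [DecidableEq V]

/-- `y = (y_e)` solves the Neumann Sturm-Liouville problem on the tree with potential `Q` and
spectral parameter `lam`; `dy e` is the derivative of `y e`. -/
structure IsNeumannSolution (T : RootedMetricTree V E) (Q : E → ℝ → ℝ) (lam : ℝ)
    (y dy : E → ℝ → ℝ) : Prop where
  solution : ∀ e, IsSturmLiouvilleSolution (T.len e) (Q e) lam (y e) (dy e)
  /-- Continuity: at each vertex `v` all the incident edges have one common value `u v`. -/
  continuity : ∃ u : V → ℝ, ∀ e, y e 0 = u (T.far e) ∧ y e (T.len e) = u (T.near e)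
  /-- Kirchhoff condition at `v`. At a vertex of degree one it involves a single edge and is the
  Neumann condition; at the root the right-hand side is an empty sum. -/
  kirchhoff : ∀ v : V, ∑ e with T.near e = v, dy e (T.len e) = ∑ e with T.far e = v, dy e 0

/-- The set of eigenvalues of the Neumann Sturm-Liouville problem with potential `Q`. -/
def neumannSpectrum (T : RootedMetricTree V E) (Q : E → ℝ → ℝ) : Set ℝ :=
  {lam | ∃ y dy : E → ℝ → ℝ, T.IsNeumannSolution Q lam y dy ∧
    ∃ e, ∃ x ∈ Icc 0 (T.len e), y e x ≠ 0}

end RootedMetricTree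

/-! The proof has two halves: equality of the spectra forces the total integral of the potential to
be zero, and a positive solution at spectral parameter `0` then forces the potential itself to
vanish.

Mean value. By simultaneous Diophantine approximation there are arbitrarily large `s` for which
every phase `s * len e` is close to a multiple of `2π`, and a small shift makes `s ^ 2` an
eigenvalue of the zero potential (`exists_large_eigenvalue`), hence also of `Q`. Along such `s`,
suitably scaled eigenfunctions `y` for `Q` and `z` for `0` are both uniformly close to `cos (s x)`
on every edge (`eventually_exists_close_to_cos`). Green's identity with the vertex conditions gives
`∑ ∫ Q y z = 0`, and in the limit, by Riemann-Lebesgue, `(1/2) ∑ ∫ Q = 0`.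

Rigidity. The zero potential has no negative eigenvalue, hence neither has `Q`. This is turned into
a positive solution at parameter `0` without operator theory, by continuation in the spectral
parameter. Consider nonnegative solutions satisfying all vertex conditions, except that the flux
into the root is only required to be nonnegative. They exist for some nonpositive parameter, they
form a closed cone, and they are strictly positive unless zero. Take the largest parameter in the
compact normalized family. If it were negative, zero flux at the root would give a negative
eigenvalue, and positive flux would let the parameter grow (`eventually_exists_mem`). So it is `0`.
For `w = y'/y` the Riccati equation `w' = Q - w²`, summed over the tree, gives `∑ ∫ w² ≤ ∑ ∫ Q = 0`;
hence `y' = 0` and `Q = 0`. -/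

/-! ### Absolute continuity and the fundamental theorem of calculus -/

theorem AbsolutelyContinuousOnInterval.congr_on {f g : ℝ → ℝ} {a b : ℝ}
    (hf : AbsolutelyContinuousOnInterval f a b) (hfg : EqOn g f (uIcc a b)) :
    AbsolutelyContinuousOnInterval g a b := by
  rw [absolutelyContinuousOnInterval_iff] at hf ⊢
  intro ε hε
  obtain ⟨δ, hδ, h⟩ := hf ε hε
  refine ⟨δ, hδ, fun I hI hl => ?_⟩
  convert h I hI hl using 1
  refine Finset.sum_congr rfl fun i hi => ?_
  rw [hfg (hI.1 i hi).1, hfg (hI.1 i hi).2]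

theorem absolutelyContinuousOnInterval_of_hasDerivWithinAt {f f' : ℝ → ℝ} {a b : ℝ} (hab : a ≤ b)
    (hf : ∀ x ∈ Icc a b, HasDerivWithinAt f (f' x) (Icc a b) x)
    (hf' : ContinuousOn f' (Icc a b)) : AbsolutelyContinuousOnInterval f a b := by
  obtain ⟨C, hC⟩ := isCompact_Icc.exists_bound_of_continuousOn hf'
  have := (convex_Icc a b).lipschitzOnWith_of_nnnorm_hasDerivWithin_le (C := C.toNNReal) hf
    (fun x hx => by
      rw [← NNReal.coe_le_coe]
      exact (hC x hx).trans (Real.le_coe_toNNReal C))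
  rw [← uIcc_of_le hab] at this
  exact this.absolutelyContinuousOnInterval

/-- For an `L¹` potential the second derivative exists only almost everywhere. Green's identity, the
energy identity and the Riccati identity are all instances of this with an explicit `F`. -/
theorem AbsolutelyContinuousOnInterval.integral_eq_sub_of_ae {F G : ℝ → ℝ} {a b x : ℝ}
    (hF : AbsolutelyContinuousOnInterval F a b)
    (hG : ∀ᵐ t ∂(volume.restrict (Ioo a b)), HasDerivAt F (G t) t)
    (hx : x ∈ Icc a b) : ∫ t in a..x, G t = F x - F a := by
  have hab : a ≤ b := hx.1.trans hx.2
  have hF' : AbsolutelyContinuousOnInterval F a x := hF.mono (by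
    rw [uIcc_of_le hx.1, uIcc_of_le hab]; exact Icc_subset_Icc_right hx.2)
  rw [← hF'.integral_deriv_eq_sub]
  apply intervalIntegral.integral_congr_ae
  rw [ae_restrict_iff' measurableSet_Ioo] at hG
  have hb : ∀ᵐ t : ℝ, t ≠ b := by simp [ae_iff, measure_singleton]
  filter_upwards [hG, hb] with t ht htb hxt
  rw [uIoc_of_le hx.1] at hxt
  exact (ht ⟨hxt.1, lt_of_le_of_ne (hxt.2.trans hx.2) htb⟩).deriv.symm

theorem ContinuousOn.exists_primitive_Icc {f : ℝ → ℝ} {a b : ℝ} (hab : a ≤ b)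
    (hf : ContinuousOn f (Icc a b)) :
    ∃ F : ℝ → ℝ, Continuous F ∧ ∀ x ∈ Icc a b, HasDerivAt F (f x) x := by
  have hc : Continuous (IccExtend hab ((Icc a b).domRestrict f)) :=
    (continuousOn_iff_continuous_domRestrict.1 hf).Icc_extend'
  have hd : ∀ x, HasDerivAt (fun x => ∫ t in a..x, IccExtend hab ((Icc a b).domRestrict f) t)
      (IccExtend hab ((Icc a b).domRestrict f) x) x := fun x =>
    (hc.integral_hasStrictDerivAt a x).hasDerivAt
  refine ⟨_, continuous_iff_continuousAt.2 fun x => (hd x).continuousAt, fun x hx => ?_⟩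
  have := hd x
  rwa [IccExtend_of_mem hab _ hx] at this

/-! ### Integral identities and positivity on one edge -/

namespace IsSturmLiouvilleSolution

variable {a lam l₁ l₂ : ℝ} {q q₁ q₂ y dy z dz : ℝ → ℝ}

theorem continuousOn (h : IsSturmLiouvilleSolution a q lam y dy) : ContinuousOn y (Icc 0 a) :=
  fun x hx => (h.hasDerivWithinAt x hx).continuousWithinAt

theorem continuousOn_deriv (ha : 0 ≤ a) (h : IsSturmLiouvilleSolution a q lam y dy) :
    ContinuousOn dy (Icc 0 a) := by
  have := h.absolutelyContinuous.continuousOn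
  rwa [uIcc_of_le ha] at this

theorem absolutelyContinuous_self (ha : 0 ≤ a) (h : IsSturmLiouvilleSolution a q lam y dy) :
    AbsolutelyContinuousOnInterval y 0 a :=
  absolutelyContinuousOnInterval_of_hasDerivWithinAt ha h.hasDerivWithinAt (h.continuousOn_deriv ha)

theorem hasDerivAt (h : IsSturmLiouvilleSolution a q lam y dy) {x : ℝ} (hx : x ∈ Ioo 0 a) :
    HasDerivAt y (dy x) x :=
  (h.hasDerivWithinAt x (Ioo_subset_Icc_self hx)).hasDerivAt (Icc_mem_nhds hx.1 hx.2)

theorem ae_hasDerivAt (h : IsSturmLiouvilleSolution a q lam y dy) :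
    ∀ᵐ x ∂(volume.restrict (Ioo 0 a)),
      HasDerivAt y (dy x) x ∧ HasDerivAt dy ((q x - lam) * y x) x := by
  filter_upwards [h.equation, ae_restrict_mem measurableSet_Ioo] with x hx hx'
  refine ⟨h.hasDerivAt hx', ?_⟩
  have := hx.1.hasDerivAt
  rwa [show deriv dy x = (q x - lam) * y x by linarith [hx.2]] at this

theorem of_ae_hasDerivAt (h₁ : ∀ x ∈ Icc 0 a, HasDerivWithinAt y (dy x) (Icc 0 a) x)
    (h₂ : AbsolutelyContinuousOnInterval dy 0 a)
    (h₃ : ∀ᵐ x ∂(volume.restrict (Ioo 0 a)), HasDerivAt dy ((q x - lam) * y x) x) :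
    IsSturmLiouvilleSolution a q lam y dy where
  hasDerivWithinAt := h₁
  absolutelyContinuous := h₂
  equation := by
    filter_upwards [h₃] with x hx
    exact ⟨hx.differentiableAt, by rw [hx.deriv]; ring⟩

theorem linear_combination (hy : IsSturmLiouvilleSolution a q lam y dy)
    (hz : IsSturmLiouvilleSolution a q lam z dz) (α β : ℝ) :
    IsSturmLiouvilleSolution a q lam (fun x => α * y x + β * z x)
      (fun x => α * dy x + β * dz x) := by
  refine of_ae_hasDerivAt (fun x hx => ((hy.hasDerivWithinAt x hx).const_mul α).add
    ((hz.hasDerivWithinAt x hx).const_mul β))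
    ((hy.absolutelyContinuous.const_mul α).add (hz.absolutelyContinuous.const_mul β)) ?_
  filter_upwards [hy.ae_hasDerivAt, hz.ae_hasDerivAt] with x hx hx'
  convert! (hx.2.const_mul α).add (hx'.2.const_mul β) using 1
  ring

theorem const_mul (hy : IsSturmLiouvilleSolution a q lam y dy) (α : ℝ) :
    IsSturmLiouvilleSolution a q lam (fun x => α * y x) (fun x => α * dy x) := by
  simpa using hy.linear_combination hy α 0

/-- Green's identity for two Sturm-Liouville equations. -/
theorem green (ha : 0 ≤ a) (hy : IsSturmLiouvilleSolution a q₁ l₁ y dy)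
    (hz : IsSturmLiouvilleSolution a q₂ l₂ z dz) {x : ℝ} (hx : x ∈ Icc 0 a) :
    ∫ t in (0 : ℝ)..x, ((q₁ t - l₁) - (q₂ t - l₂)) * y t * z t =
      (dy x * z x - y x * dz x) - (dy 0 * z 0 - y 0 * dz 0) := by
  refine AbsolutelyContinuousOnInterval.integral_eq_sub_of_ae
    (F := fun t => dy t * z t - y t * dz t)
    ((hy.absolutelyContinuous.mul (hz.absolutelyContinuous_self ha)).sub
      ((hy.absolutelyContinuous_self ha).mul hz.absolutelyContinuous)) ?_ hx
  filter_upwards [hy.ae_hasDerivAt, hz.ae_hasDerivAt] with t ht ht'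
  convert! (ht.2.mul ht'.1).sub (ht.1.mul ht'.2) using 1
  ring

/-- Integrates `(y' y)' = y'² + y'' y`; with zero potential it rules out negative eigenvalues. -/
theorem energy (ha : 0 ≤ a) (hy : IsSturmLiouvilleSolution a q lam y dy) :
    ∫ t in (0 : ℝ)..a, (dy t ^ 2 + (q t - lam) * y t ^ 2) = dy a * y a - dy 0 * y 0 := by
  refine AbsolutelyContinuousOnInterval.integral_eq_sub_of_ae
    (F := fun t => dy t * y t)
    (hy.absolutelyContinuous.mul (hy.absolutelyContinuous_self ha)) ?_ (right_mem_Icc.2 ha)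
  filter_upwards [hy.ae_hasDerivAt] with t ht
  convert! ht.2.mul ht.1 using 1
  ring

/-- The Riccati equation for the logarithmic derivative of a positive solution. -/
theorem riccati (ha : 0 ≤ a) (hy : IsSturmLiouvilleSolution a q lam y dy)
    (hpos : ∀ x ∈ Icc 0 a, 0 < y x) :
    ∫ t in (0 : ℝ)..a, (q t - lam - (dy t / y t) ^ 2) = dy a / y a - dy 0 / y 0 := by
  have hinv : AbsolutelyContinuousOnInterval (fun t => (y t)⁻¹) 0 a :=
    absolutelyContinuousOnInterval_of_hasDerivWithinAt ha
      (fun x hx => (hy.hasDerivWithinAt x hx).inv (hpos x hx).ne')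
      ((hy.continuousOn_deriv ha).neg.div (hy.continuousOn.pow 2)
        fun x hx => pow_ne_zero 2 (hpos x hx).ne')
  refine AbsolutelyContinuousOnInterval.integral_eq_sub_of_ae
    (F := fun t => dy t / y t) ?_ ?_ (right_mem_Icc.2 ha)
  · simpa only [div_eq_mul_inv] using hy.absolutelyContinuous.fun_mul hinv
  filter_upwards [hy.ae_hasDerivAt, ae_restrict_mem measurableSet_Ioo] with t ht htm
  have hne := (hpos t (Ioo_subset_Icc_self htm)).ne'
  convert! ht.2.div ht.1 hne using 1
  field_simp

/-- For a sufficiently negative spectral parameter, solutions that start positive and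
nondecreasing stay positive and end up nondecreasing. -/
theorem pos_of_le_neg (ha : 0 < a) (hq : IntegrableOn q (Icc 0 a))
    (hy : IsSturmLiouvilleSolution a q lam y dy) (h0 : 0 < y 0) (h0' : 0 ≤ dy 0)
    (hlam : lam ≤ -((∫ t in (0 : ℝ)..a, |q t|) / a + 4 * (∫ t in (0 : ℝ)..a, |q t|) ^ 2)) :
    (∀ x ∈ Icc 0 a, 0 < y x) ∧ 0 ≤ dy a := by
  set K := ∫ t in (0 : ℝ)..a, |q t| with hK
  have hqi : IntervalIntegrable q volume 0 a := by
    rw [intervalIntegrable_iff_integrableOn_Icc_of_le ha.le]; exact hq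
  have hK0 : 0 ≤ K := intervalIntegral.integral_nonneg ha.le fun _ _ => abs_nonneg _
  set p : ℝ → ℝ := fun x => ∫ t in (0 : ℝ)..x, q t with hp
  have hpac : AbsolutelyContinuousOnInterval p 0 a :=
    hqi.absolutelyContinuousOnInterval_intervalIntegral (by simp)
  have hpK : ∀ x ∈ Icc 0 a, |p x| ≤ K := by
    intro x hx
    calc |p x| ≤ ∫ t in (0 : ℝ)..x, |q t| := intervalIntegral.abs_integral_le_integral_abs hx.1
      _ ≤ K := intervalIntegral.integral_mono_interval le_rfl hx.1 hx.2
        (Filter.Eventually.of_forall fun _ => abs_nonneg _) hqi.abs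
  -- The linear term makes `ψ a = p a + K ≥ 0` while keeping `ψ 0 = 0` and `|ψ| ≤ 2K`. The threshold
  -- on `lam` adds its slope `K / a` to the bound `4K²` for `ψ²`.
  set ψ : ℝ → ℝ := fun x => p x + K / a * x with hψ
  have hlin : AbsolutelyContinuousOnInterval (fun x : ℝ => K / a * x) 0 a :=
    (by fun_prop : ContDiff ℝ 1 fun x : ℝ => K / a * x).contDiffOn.absolutelyContinuousOnInterval
  have hψac : AbsolutelyContinuousOnInterval ψ 0 a := hpac.fun_add hlin
  have hψc : ContinuousOn ψ (Icc 0 a) := by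
    have := hψac.continuousOn; rwa [uIcc_of_le ha.le] at this
  have hψK : ∀ x ∈ Icc 0 a, ψ x ^ 2 ≤ 4 * K ^ 2 := by
    intro x hx
    have h1 := abs_le.1 (hpK x hx)
    have h2 : K / a * x ≤ K := by
      rw [div_mul_eq_mul_div, div_le_iff₀ ha]; exact mul_le_mul_of_nonneg_left hx.2 hK0
    have h3 : 0 ≤ K / a * x := mul_nonneg (div_nonneg hK0 ha.le) hx.1
    have : |ψ x| ≤ 2 * K := abs_le.2 ⟨by simp only [hψ]; linarith, by simp only [hψ]; linarith⟩
    calc ψ x ^ 2 = |ψ x| ^ 2 := (sq_abs _).symm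
      _ ≤ (2 * K) ^ 2 := by gcongr
      _ = _ := by ring
  obtain ⟨Ψ, hΨc, hΨ⟩ := hψc.exists_primitive_Icc ha.le
  have hE : AbsolutelyContinuousOnInterval (fun x => Real.exp (Ψ x)) 0 a :=
    absolutelyContinuousOnInterval_of_hasDerivWithinAt ha.le
      (fun x hx => (hΨ x hx).exp.hasDerivWithinAt) (hΨc.rexp.continuousOn.mul hψc)
  have hE' : AbsolutelyContinuousOnInterval (fun x => Real.exp (-Ψ x)) 0 a :=
    absolutelyContinuousOnInterval_of_hasDerivWithinAt ha.le
      (fun x hx => (hΨ x hx).neg.exp.hasDerivWithinAt) (hΨc.neg.rexp.continuousOn.mul hψc.neg)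
  have hψ0 : ψ 0 = 0 := by simp [hψ, hp]
  -- A quasi-derivative: `q` cancels and `H' + ψ H = (-lam - K/a - ψ²) y`, with nonnegative
  -- coefficient on the right, while `y' - ψ y = H`. The factors `exp Ψ` and `exp (-Ψ)` integrate
  -- these two first-order equations.
  set H : ℝ → ℝ := fun x => dy x - ψ x * y x with hH
  have hHac : AbsolutelyContinuousOnInterval H 0 a :=
    hy.absolutelyContinuous.fun_sub (hψac.fun_mul (hy.absolutelyContinuous_self ha.le))
  have hHd : ∀ᵐ t ∂(volume.restrict (Ioo 0 a)), HasDerivAt (fun x => H x * Real.exp (Ψ x))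
      ((-lam - K / a - ψ t ^ 2) * y t * Real.exp (Ψ t)) t := by
    have hpd := hqi.ae_hasDerivAt_integral
    rw [uIcc_of_le ha.le] at hpd
    filter_upwards [hy.ae_hasDerivAt, ae_restrict_mem measurableSet_Ioo,
      ae_restrict_of_ae hpd] with t ht htm htp
    have hm := Ioo_subset_Icc_self htm
    have h1 : HasDerivAt ψ (q t + K / a) t := by
      convert! (htp hm 0 (left_mem_Icc.2 ha.le)).add ((hasDerivAt_id t).const_mul (K / a)) using 1
      ring
    convert! (ht.2.sub (h1.mul ht.1)).mul (hΨ t hm).exp using 1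
    simp only [Pi.sub_apply, Pi.mul_apply]
    ring
  have hnonneg : ∀ x ∈ Icc 0 a, (∀ t ∈ Icc 0 x, 0 ≤ y t) → 0 ≤ H x := by
    intro x hx hyx
    have h1 := (hHac.fun_mul hE).integral_eq_sub_of_ae hHd hx
    have h2 : 0 ≤ ∫ t in (0 : ℝ)..x, (-lam - K / a - ψ t ^ 2) * y t * Real.exp (Ψ t) := by
      refine intervalIntegral.integral_nonneg hx.1 fun t ht => ?_
      have := hψK t ⟨ht.1, ht.2.trans hx.2⟩
      exact mul_nonneg (mul_nonneg (by linarith) (hyx t ht)) (Real.exp_pos _).le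
    have h3 : 0 ≤ H 0 * Real.exp (Ψ 0) :=
      mul_nonneg (by simp only [hH, hψ0]; linarith) (Real.exp_pos _).le
    exact nonneg_of_mul_nonneg_left (by linarith) (Real.exp_pos (Ψ x))
  have hZd : ∀ᵐ t ∂(volume.restrict (Ioo 0 a)), HasDerivAt (fun x => y x * Real.exp (-Ψ x))
      (H t * Real.exp (-Ψ t)) t := by
    filter_upwards [hy.ae_hasDerivAt, ae_restrict_mem measurableSet_Ioo] with t ht htm
    convert! ht.1.mul (hΨ t (Ioo_subset_Icc_self htm)).neg.exp using 1
    simp only [hH, Pi.neg_apply]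
    ring
  have hpos : ∀ x ∈ Icc 0 a, 0 < y x := by
    by_contra! hcon
    set S : Set ℝ := Icc 0 a ∩ y ⁻¹' Iic 0 with hS
    have hSc : IsClosed S := hy.continuousOn.preimage_isClosed_of_isClosed isClosed_Icc isClosed_Iic
    have hSne : S.Nonempty := let ⟨x, hx, hx'⟩ := hcon; ⟨x, hx, hx'⟩
    have hSb : BddBelow S := ⟨0, fun x hx => hx.1.1⟩
    have hx₁ := hSc.csInf_mem hSne hSb
    -- At the first zero `x₁`: before it `y > 0`, so `H ≥ 0`, so `y exp (-Ψ)` cannot have decreased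
    -- from its positive initial value.
    set x₁ := sInf S
    have hlt : ∀ t ∈ Ico 0 x₁, 0 < y t := by
      intro t ht
      by_contra! h
      exact absurd (csInf_le hSb (⟨⟨ht.1, ht.2.le.trans hx₁.1.2⟩, h⟩ : t ∈ S)) (not_le.2 ht.2)
    have h1 := ((hy.absolutelyContinuous_self ha.le).fun_mul hE').integral_eq_sub_of_ae hZd hx₁.1
    have h2 : 0 ≤ ∫ t in (0 : ℝ)..x₁, H t * Real.exp (-Ψ t) := by
      refine intervalIntegral.integral_nonneg_of_ae_restrict hx₁.1.1 ?_
      have hb : ∀ᵐ t : ℝ, t ≠ x₁ := by simp [ae_iff, measure_singleton]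
      filter_upwards [ae_restrict_mem measurableSet_Icc, ae_restrict_of_ae hb] with t ht htb
      refine mul_nonneg (hnonneg t ⟨ht.1, ht.2.trans hx₁.1.2⟩ fun r hr => ?_) (Real.exp_pos _).le
      exact (hlt r ⟨hr.1, hr.2.trans_lt (lt_of_le_of_ne ht.2 htb)⟩).le
    have h3 : 0 < y 0 * Real.exp (-Ψ 0) := mul_pos h0 (Real.exp_pos _)
    have h4 : y x₁ * Real.exp (-Ψ x₁) ≤ 0 :=
      mul_nonpos_of_nonpos_of_nonneg hx₁.2 (Real.exp_pos _).le
    linarith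
  refine ⟨hpos, ?_⟩
  have ha' := right_mem_Icc.2 ha.le
  have h1 := hnonneg a ha' fun t ht => (hpos t ht).le
  have h2 : 0 ≤ ψ a := by
    have := (abs_le.1 (hpK a ha')).1
    simp only [hψ]
    rw [div_mul_cancel₀ _ ha.ne']
    linarith
  have := mul_nonneg h2 (hpos a ha').le
  simp only [hH] at h1
  linarith

end IsSturmLiouvilleSolution

/-! ### The initial value problem as a Volterra equation -/

section Volterra

variable {a : ℝ} {p : ℝ → ℝ}

/-- The operator `y ↦ (x ↦ ∫₀ˣ p y)` on `C([0, a])`. -/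
noncomputable def volterra (ha : 0 ≤ a) (hp : IntervalIntegrable p volume 0 a) :
    C(Icc (0 : ℝ) a, ℝ) →L[ℝ] C(Icc (0 : ℝ) a, ℝ) :=
  have hint : ∀ (y : C(Icc (0 : ℝ) a, ℝ)),
      IntervalIntegrable (fun t => p t * IccExtend ha y t) volume 0 a := fun y =>
    hp.mul_continuousOn y.continuous.Icc_extend'.continuousOn
  have hint' : ∀ (y : C(Icc (0 : ℝ) a, ℝ)) (x : Icc (0 : ℝ) a),
      IntervalIntegrable (fun t => p t * IccExtend ha y t) volume 0 x := fun y x =>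
    (hint y).mono_set (by
      rw [uIcc_of_le ha, uIcc_of_le x.2.1]; exact Icc_subset_Icc_right x.2.2)
  LinearMap.mkContinuous
    { toFun := fun y => ⟨fun x => ∫ t in (0 : ℝ)..x, p t * IccExtend ha y t, by
        have := (hint y).absolutelyContinuousOnInterval_intervalIntegral
          (c := 0) (by simp) |>.continuousOn
        rw [uIcc_of_le ha] at this
        exact continuousOn_iff_continuous_domRestrict.1 this⟩
      map_add' := fun y z => by
        ext x
        change ∫ t in (0 : ℝ)..x, p t * IccExtend ha (y + z) t =
          (∫ t in (0 : ℝ)..x, p t * IccExtend ha y t) + ∫ t in (0 : ℝ)..x, p t * IccExtend ha z t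
        rw [← intervalIntegral.integral_add (hint' y x) (hint' z x)]
        congr 1
        ext t
        simp [IccExtend, mul_add]
      map_smul' := fun r y => by
        ext x
        change ∫ t in (0 : ℝ)..x, p t * IccExtend ha (r • y) t =
          r * ∫ t in (0 : ℝ)..x, p t * IccExtend ha y t
        rw [← intervalIntegral.integral_const_mul]
        congr 1
        ext t
        simp [IccExtend]
        ring }
    (∫ t in (0 : ℝ)..a, |p t|) (fun y => by
      have h0 : 0 ≤ ∫ t in (0 : ℝ)..a, |p t| :=
        intervalIntegral.integral_nonneg ha fun _ _ => abs_nonneg _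
      rw [ContinuousMap.norm_le _ (mul_nonneg h0 (norm_nonneg _))]
      intro x
      simp only [LinearMap.coe_mk, AddHom.coe_mk, Real.norm_eq_abs]
      calc |∫ t in (0 : ℝ)..x, p t * IccExtend ha y t|
          ≤ ∫ t in (0 : ℝ)..x, |p t * IccExtend ha y t| :=
            intervalIntegral.abs_integral_le_integral_abs x.2.1
        _ ≤ ∫ t in (0 : ℝ)..a, |p t * IccExtend ha y t| :=
            intervalIntegral.integral_mono_interval le_rfl x.2.1 x.2.2
              (Filter.Eventually.of_forall fun _ => abs_nonneg _) (hint y).abs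
        _ ≤ ∫ t in (0 : ℝ)..a, |p t| * ‖y‖ := by
            refine intervalIntegral.integral_mono_on ha (hint y).abs (hp.abs.mul_const _) ?_
            intro t ht
            rw [abs_mul]
            gcongr
            exact y.norm_coe_le_norm _
        _ = (∫ t in (0 : ℝ)..a, |p t|) * ‖y‖ := intervalIntegral.integral_mul_const _ _)

theorem volterra_apply (ha : 0 ≤ a) (hp : IntervalIntegrable p volume 0 a)
    (y : C(Icc (0 : ℝ) a, ℝ)) (x : Icc (0 : ℝ) a) :
    volterra ha hp y x = ∫ t in (0 : ℝ)..x, p t * IccExtend ha y t := rfl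

/-- A pointwise bound instead of a norm bound, because the factorial decay of the iterates comes
from the dependence on `x`. -/
theorem abs_volterra_apply_le (ha : 0 ≤ a) (hp : IntervalIntegrable p volume 0 a)
    {y : C(Icc (0 : ℝ) a, ℝ)} {g : ℝ → ℝ} (hg : ContinuousOn g (Icc 0 a))
    (hy : ∀ x : Icc (0 : ℝ) a, |y x| ≤ g x) (x : Icc (0 : ℝ) a) :
    |volterra ha hp y x| ≤ ∫ t in (0 : ℝ)..x, |p t| * g t := by
  rw [volterra_apply]
  have hsub : uIcc (0 : ℝ) x ⊆ uIcc 0 a := by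
    rw [uIcc_of_le ha, uIcc_of_le x.2.1]; exact Icc_subset_Icc_right x.2.2
  have hpx : IntervalIntegrable p volume 0 x := hp.mono_set hsub
  refine (intervalIntegral.abs_integral_le_integral_abs x.2.1).trans
    (intervalIntegral.integral_mono_on x.2.1
      (hpx.mul_continuousOn y.continuous.Icc_extend'.continuousOn).abs
      (hpx.abs.mul_continuousOn (hg.mono (by rw [uIcc_of_le ha] at hsub; exact hsub))) ?_)
  intro t ht
  have ht' : t ∈ Icc 0 a := ⟨ht.1, ht.2.trans x.2.2⟩
  rw [abs_mul, IccExtend_of_mem ha _ ht']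
  gcongr
  exact hy ⟨t, ht'⟩

/-- The double integration operator `y ↦ (x ↦ ∫₀ˣ ∫₀ᵗ p y)`. -/
noncomputable def volterraTwo (ha : 0 ≤ a) (hp : IntervalIntegrable p volume 0 a) :
    C(Icc (0 : ℝ) a, ℝ) →L[ℝ] C(Icc (0 : ℝ) a, ℝ) :=
  (volterra ha (p := fun _ => 1) intervalIntegrable_const).comp (volterra ha hp)

/-- Induction on `n`: with `P x = ∫₀ˣ |p|`, the inner integration gains the factorial through `∫ |p|
P ^ n = P ^ (n + 1) / (n + 1)`, and the outer one costs at most a factor `a`, since `P` is monotone.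
-/
theorem abs_volterraTwo_pow_le (ha : 0 ≤ a) (hp : IntervalIntegrable p volume 0 a)
    (y : C(Icc (0 : ℝ) a, ℝ)) (n : ℕ) (x : Icc (0 : ℝ) a) :
    |(volterraTwo ha hp ^ n) y x| ≤ ‖y‖ * (a * ∫ t in (0 : ℝ)..x, |p t|) ^ n / n.factorial := by
  set P : ℝ → ℝ := fun x => ∫ t in (0 : ℝ)..x, |p t| with hP
  have hPac : AbsolutelyContinuousOnInterval P 0 a :=
    hp.abs.absolutelyContinuousOnInterval_intervalIntegral (by simp)
  have hPc : ContinuousOn P (Icc 0 a) := by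
    have := hPac.continuousOn; rwa [uIcc_of_le ha] at this
  have hPmono : ∀ s ∈ Icc 0 a, ∀ t ∈ Icc 0 s, P t ≤ P s := by
    intro s hs t ht
    refine intervalIntegral.integral_mono_interval le_rfl ht.1 ht.2
      (Filter.Eventually.of_forall fun _ => abs_nonneg _) (hp.abs.mono_set ?_)
    rw [uIcc_of_le ha, uIcc_of_le hs.1]; exact Icc_subset_Icc_right hs.2
  have hP0 : ∀ t ∈ Icc 0 a, 0 ≤ P t := fun t ht =>
    intervalIntegral.integral_nonneg ht.1 fun _ _ => abs_nonneg _
  have hpow : ∀ n : ℕ, AbsolutelyContinuousOnInterval (fun x => P x ^ (n + 1)) 0 a := by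
    intro n
    induction n with
    | zero => simpa using hPac
    | succ n ih => simpa only [pow_succ] using ih.fun_mul hPac
  have hPd := hp.abs.ae_hasDerivAt_integral
  rw [uIcc_of_le ha] at hPd
  have hint : ∀ (n : ℕ), ∀ x ∈ Icc 0 a,
      ∫ t in (0 : ℝ)..x, |p t| * P t ^ n = P x ^ (n + 1) / (n + 1) := by
    intro n x hx
    have h := (hpow n).integral_eq_sub_of_ae (G := fun t => (n + 1) * (|p t| * P t ^ n)) ?_ hx
    · rw [intervalIntegral.integral_const_mul] at h
      have : P 0 = 0 := by simp [hP]
      rw [this] at h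
      field_simp
      simpa [mul_comm] using h
    · filter_upwards [ae_restrict_mem measurableSet_Ioo, ae_restrict_of_ae hPd] with t htm ht
      have := (ht (Ioo_subset_Icc_self htm) 0 (left_mem_Icc.2 ha)).pow (n + 1)
      convert! this using 1
      rw [Nat.add_sub_cancel]
      push_cast
      ring
  induction n generalizing x with
  | zero => simpa using y.norm_coe_le_norm x
  | succ n ih =>
    rw [pow_succ', mul_apply_eq_comp]
    have hb : ∀ x : Icc (0 : ℝ) a, |volterra ha hp ((volterraTwo ha hp ^ n) y) x| ≤
        ‖y‖ * a ^ n / (n + 1).factorial * P x ^ (n + 1) := by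
      intro x
      refine (abs_volterra_apply_le ha hp (g := fun x => ‖y‖ * (a * P x) ^ n / n.factorial)
        (by fun_prop) ih x).trans_eq ?_
      rw [show (fun t => |p t| * (‖y‖ * (a * P t) ^ n / n.factorial)) =
        fun t => ‖y‖ * a ^ n / n.factorial * (|p t| * P t ^ n) by ext t; rw [mul_pow]; ring,
        intervalIntegral.integral_const_mul, hint n x x.2, Nat.factorial_succ]
      push_cast
      field_simp
    refine (abs_volterra_apply_le ha intervalIntegrable_const
      (g := fun x => ‖y‖ * a ^ n / (n + 1).factorial * P x ^ (n + 1)) (by fun_prop) hb x).trans ?_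
    have hsub : uIcc (0 : ℝ) x ⊆ Icc 0 a := by
      rw [uIcc_of_le x.2.1]; exact Icc_subset_Icc_right x.2.2
    calc ∫ t in (0 : ℝ)..x, |(1 : ℝ)| * (‖y‖ * a ^ n / (n + 1).factorial * P t ^ (n + 1))
        ≤ ∫ t in (0 : ℝ)..x, ‖y‖ * a ^ n / (n + 1).factorial * P x ^ (n + 1) := by
          refine intervalIntegral.integral_mono_on x.2.1 ?_ intervalIntegrable_const ?_
          · apply ContinuousOn.intervalIntegrable
            have := hPc.mono hsub
            fun_prop
          · intro t ht
            rw [abs_one, one_mul]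
            have h1 := hP0 t ⟨ht.1, ht.2.trans x.2.2⟩
            have h2 := hPmono x x.2 t ht
            gcongr
      _ = x * (‖y‖ * a ^ n / (n + 1).factorial * P x ^ (n + 1)) := by
          rw [intervalIntegral.integral_const, sub_zero, smul_eq_mul]
      _ ≤ a * (‖y‖ * a ^ n / (n + 1).factorial * P x ^ (n + 1)) := by
          have h1 := hP0 x x.2
          have h2 := x.2.2
          gcongr
      _ = _ := by rw [mul_pow]; ring

/-- Some power `W ^ n` of the operator has norm below `1`, so `1 - W ^ n` is invertible, and `1 - W`
is one of its two commuting factors. -/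
theorem isUnit_one_sub_volterraTwo (ha : 0 ≤ a) (hp : IntervalIntegrable p volume 0 a) :
    IsUnit (1 - volterraTwo ha hp) := by
  set B := a * ∫ t in (0 : ℝ)..a, |p t| with hB
  have hB0 : 0 ≤ B := mul_nonneg ha (intervalIntegral.integral_nonneg ha fun _ _ => abs_nonneg _)
  obtain ⟨n, hn⟩ := ((FloorSemiring.tendsto_pow_div_factorial_atTop B).eventually
    (gt_mem_nhds one_pos)).exists
  have hnorm : ‖volterraTwo ha hp ^ n‖ < 1 := by
    refine lt_of_le_of_lt (ContinuousLinearMap.opNorm_le_bound _ (by positivity) fun y => ?_) hn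
    rw [ContinuousMap.norm_le _ (by positivity)]
    intro x
    refine (abs_volterraTwo_pow_le ha hp y n x).trans ?_
    have h1 : ∫ t in (0 : ℝ)..x, |p t| ≤ ∫ t in (0 : ℝ)..a, |p t| :=
      intervalIntegral.integral_mono_interval le_rfl x.2.1 x.2.2
        (Filter.Eventually.of_forall fun _ => abs_nonneg _) hp.abs
    have h2 : 0 ≤ ∫ t in (0 : ℝ)..x, |p t| :=
      intervalIntegral.integral_nonneg x.2.1 fun _ _ => abs_nonneg _
    rw [div_mul_eq_mul_div, mul_comm ‖y‖, hB]
    gcongr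
  have hu : IsUnit (1 - volterraTwo ha hp ^ n) := 
    isUnit_one_sub_of_norm_lt_one (R := C(Icc (0 : ℝ) a, ℝ) →L[ℝ] C(Icc (0 : ℝ) a, ℝ)) hnorm
  rw [← mul_neg_geom_sum (volterraTwo ha hp) n] at hu
  exact (Commute.isUnit_mul_iff (Commute.sum_right _ _ _ fun i _ =>
    (Commute.one_left _).sub_left ((Commute.refl _).pow_right i))).1 hu |>.1

/-- Affine dependence on `l` yields continuity in operator norm. -/
theorem volterra_sub_const (ha : 0 ≤ a) {q : ℝ → ℝ} (hq : IntervalIntegrable q volume 0 a)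
    (l : ℝ) (hql : IntervalIntegrable (fun t => q t - l) volume 0 a) :
    volterra ha hql =
      volterra ha hq - l • volterra ha (p := fun _ => 1) intervalIntegrable_const := by
  ext y x
  simp only [volterra_apply, sub_apply, smul_apply, ContinuousMap.sub_apply,
    ContinuousMap.smul_apply, smul_eq_mul]
  have hsub : uIcc (0 : ℝ) x ⊆ uIcc 0 a := by
    rw [uIcc_of_le ha, uIcc_of_le x.2.1]; exact Icc_subset_Icc_right x.2.2
  have hy : ContinuousOn (IccExtend ha y) (uIcc 0 x) := y.continuous.Icc_extend'.continuousOn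
  rw [← intervalIntegral.integral_const_mul, ← intervalIntegral.integral_sub
    ((hq.mono_set hsub).mul_continuousOn hy)
    ((intervalIntegrable_const.mul_continuousOn hy).const_mul l)]
  congr 1
  ext t
  ring

/-- Existence of solutions of the initial value problem, jointly continuous in the spectral
parameter and the position. -/
theorem exists_isSturmLiouvilleSolution (ha : 0 ≤ a) {q : ℝ → ℝ} (hq : IntegrableOn q (Icc 0 a))
    (α β : ℝ) :
    ∃ y dy : ℝ → ℝ → ℝ, Continuous (fun z : ℝ × ℝ => y z.1 z.2) ∧
      Continuous (fun z : ℝ × ℝ => dy z.1 z.2) ∧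
      ∀ l, IsSturmLiouvilleSolution a q l (y l) (dy l) ∧ y l 0 = α ∧ dy l 0 = β := by
  have hqi : IntervalIntegrable q volume 0 a := by
    rw [intervalIntegrable_iff_integrableOn_Icc_of_le ha]; exact hq
  have hql : ∀ l : ℝ, IntervalIntegrable (fun t => q t - l) volume 0 a := fun l =>
    hqi.sub intervalIntegrable_const
  set J := volterra ha (p := fun _ => 1) intervalIntegrable_const with hJ
  have hV : ∀ l, volterra ha (hql l) = volterra ha hqi - l • J := fun l =>
    volterra_sub_const ha hqi l (hql l)
  have hVc : Continuous fun l => volterra ha (hql l) := by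
    simp_rw [hV]
    fun_prop
  have hWc : Continuous fun l => volterraTwo ha (hql l) :=
    continuous_const.clm_comp hVc
  set g : C(Icc (0 : ℝ) a, ℝ) := ⟨fun x => α + β * x, by fun_prop⟩ with hg
  -- The problem in integral form is `Y = g + J (V Y)`. Inversion is continuous at units, so `Y`
  -- depends continuously on `l` in the sup norm, and evaluation then gives joint continuity.
  set Y : ℝ → C(Icc (0 : ℝ) a, ℝ) := fun l => Ring.inverse (1 - volterraTwo ha (hql l)) g with hY
  have hYc : Continuous Y := by
    have : Continuous fun l => Ring.inverse (1 - volterraTwo ha (hql l)) := by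
      rw [continuous_iff_continuousAt]
      intro l
      obtain ⟨u, hu⟩ := isUnit_one_sub_volterraTwo ha (hql l)
      have h1 := NormedRing.inverse_continuousAt
        (R := C(Icc (0 : ℝ) a, ℝ) →L[ℝ] C(Icc (0 : ℝ) a, ℝ)) u
      rw [hu] at h1
      exact ContinuousAt.comp (f := fun l => 1 - volterraTwo ha (hql l)) h1
        (continuous_const.sub hWc).continuousAt
    exact this.clm_apply continuous_const
  have hYeq : ∀ l, Y l = g + J (volterra ha (hql l) (Y l)) := by
    intro l
    have h1 := Ring.mul_inverse_cancel _ (isUnit_one_sub_volterraTwo ha (hql l))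
    have h2 := congrArg (fun L => L g) h1
    simp only [mul_apply_eq_comp, one_apply_eq_self, sub_apply] at h2
    exact sub_eq_iff_eq_add.1 h2
  set D : ℝ → C(Icc (0 : ℝ) a, ℝ) := fun l =>
    ContinuousMap.const _ β + volterra ha (hql l) (Y l) with hD
  have hDc : Continuous D := continuous_const.add (hVc.clm_apply hYc)
  have hproj : Continuous (projIcc 0 a ha) := continuous_projIcc
  have hjoint : ∀ {F : ℝ → C(Icc (0 : ℝ) a, ℝ)}, Continuous F →
      Continuous fun z : ℝ × ℝ => IccExtend ha (F z.1) z.2 := fun {F} hF => by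
    have : Continuous fun z : ℝ × ℝ => (F z.1) (projIcc 0 a ha z.2) :=
      (hF.comp continuous_fst).eval (hproj.comp continuous_snd)
    exact this
  refine ⟨fun l => IccExtend ha (Y l), fun l => IccExtend ha (D l), hjoint hYc, hjoint hDc,
    fun l => ⟨?_, ?_, ?_⟩⟩
  · have hYx : ∀ x ∈ Icc 0 a, IccExtend ha (Y l) x =
        α + ∫ t in (0 : ℝ)..x, IccExtend ha (D l) t := by
      intro x hx
      rw [IccExtend_of_mem ha _ hx]
      conv_lhs => rw [hYeq l]
      have hi : ∀ F : C(Icc (0 : ℝ) a, ℝ), IntervalIntegrable (IccExtend ha F) volume 0 x := fun F =>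
        F.continuous.Icc_extend'.intervalIntegrable _ _
      have h1 : (fun t => IccExtend ha (D l) t) =
          fun t => β + IccExtend ha (volterra ha (hql l) (Y l)) t := by
        ext t; simp [IccExtend, hD]
      rw [h1, intervalIntegral.integral_add intervalIntegrable_const (hi _)]
      simp [hg, hJ, volterra_apply]
      ring
    have hDx : ∀ x ∈ Icc 0 a, IccExtend ha (D l) x =
        β + ∫ t in (0 : ℝ)..x, (q t - l) * IccExtend ha (Y l) t := by
      intro x hx
      rw [IccExtend_of_mem ha _ hx]
      simp [hD, volterra_apply]
    have hint : IntervalIntegrable (fun t => (q t - l) * IccExtend ha (Y l) t) volume 0 a :=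
      (hql l).mul_continuousOn (Y l).continuous.Icc_extend'.continuousOn
    refine IsSturmLiouvilleSolution.of_ae_hasDerivAt (fun x hx => ?_) ?_ ?_
    · have h1 : HasDerivAt (fun x => α + ∫ t in (0 : ℝ)..x, IccExtend ha (D l) t)
          (IccExtend ha (D l) x) x :=
        (((D l).continuous.Icc_extend').integral_hasStrictDerivAt 0 x).hasDerivAt.const_add α
      exact h1.hasDerivWithinAt.congr hYx (hYx x hx)
    · have h1 := hint.absolutelyContinuousOnInterval_intervalIntegral (c := 0) (by simp)
      have h2 : AbsolutelyContinuousOnInterval (fun _ : ℝ => β) 0 a :=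
        contDiffOn_const.absolutelyContinuousOnInterval
      refine (h2.fun_add h1).congr_on ?_
      rw [uIcc_of_le ha]
      exact hDx
    · have h1 := hint.ae_hasDerivAt_integral
      rw [uIcc_of_le ha] at h1
      filter_upwards [ae_restrict_mem measurableSet_Ioo, ae_restrict_of_ae h1] with t ht ht'
      have h2 := (ht' (Ioo_subset_Icc_self ht) 0 (left_mem_Icc.2 ha)).const_add β
      refine h2.congr_of_eventuallyEq ?_
      filter_upwards [Icc_mem_nhds ht.1 ht.2] with r hr using hDx r hr
  · have h0 := left_mem_Icc.2 ha
    simp only [IccExtend_of_mem ha _ h0]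
    rw [hYeq l]
    simp [hg, hJ, volterra_apply]
  · simp [hD, volterra_apply]

end Volterra

/-! ### Induction and recursion on rooted trees -/

namespace RootedMetricTree

section Tree

variable {V E : Type*} (T : RootedMetricTree V E)

theorem far_ne_root (e : E) : T.far e ≠ T.root := by
  intro h
  have := T.dist_far e
  rw [h, SimpleGraph.dist_self] at this
  omega

/-- The first edge of a shortest path from `v` to the root has `v` as far end: the opposite
orientation would put the next vertex of the path further from the root than `v`. -/
theorem exists_far_eq {v : V} (hv : v ≠ T.root) : ∃ e, T.far e = v := by
  obtain ⟨p, hp⟩ := T.isTree.connected.exists_walk_length_eq_dist v T.root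
  cases p with
  | nil => exact absurd rfl hv
  | @cons _ w _ hadj p =>
    refine ⟨T.edge.symm ⟨s(v, w), hadj⟩, ?_⟩
    have h := T.edge_eq (T.edge.symm ⟨s(v, w), hadj⟩)
    have hd := T.dist_far (T.edge.symm ⟨s(v, w), hadj⟩)
    rw [Equiv.apply_symm_apply] at h
    rcases Sym2.eq_iff.1 h with h | h
    · exact h.1.symm
    · rw [← h.1, ← h.2, SimpleGraph.dist_comm, SimpleGraph.dist_comm (v := v)] at hd
      rw [SimpleGraph.Walk.length_cons] at hp
      have := SimpleGraph.dist_le p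
      omega

/-- Counting: a tree has one edge fewer than vertices, and `far` maps the edges onto the non-root
vertices. Acyclicity enters through this edge count. -/
theorem far_injective [Fintype V] [Fintype E] : Function.Injective T.far := by
  classical
  have : Fintype T.graph.edgeSet := Fintype.ofEquiv E T.edge
  have hcard := T.isTree.card_edgeFinset
  rw [SimpleGraph.edgeFinset_card, ← Fintype.card_congr T.edge] at hcard
  let f : E → {v // v ≠ T.root} := fun e => ⟨T.far e, T.far_ne_root e⟩
  have hf : Function.Surjective f := fun v =>
    (T.exists_far_eq v.2).imp fun e he => Subtype.ext he
  have hc : Fintype.card E = Fintype.card {v // v ≠ T.root} := by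
    rw [Fintype.card_subtype_compl, Fintype.card_subtype_eq]
    omega
  have hinj := ((Fintype.bijective_iff_surjective_and_card f).2 ⟨hf, hc⟩).1
  exact fun e e' h => hinj (Subtype.ext h)

theorem filter_far_eq [Fintype V] [DecidableEq V] [Fintype E] (e : E) :
    Finset.univ.filter (fun e' => T.far e' = T.far e) = {e} := by
  ext e'
  simp [T.far_injective.eq_iff]

theorem filter_far_root [DecidableEq V] [Fintype E] :
    Finset.univ.filter (fun e => T.far e = T.root) = ∅ := by
  ext e
  simp [T.far_ne_root]

/-- Induction from the root towards the leaves. -/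
theorem induction_down {P : V → Prop} (h₀ : P T.root) (h : ∀ e, P (T.near e) → P (T.far e))
    (v : V) : P v := by
  induction hn : T.graph.dist T.root v generalizing v with
  | zero => rwa [← T.isTree.connected.dist_eq_zero_iff.1 hn]
  | succ n ih =>
    have hv : v ≠ T.root := by
      rintro rfl
      simp at hn
    obtain ⟨e, rfl⟩ := T.exists_far_eq hv
    exact h e (ih _ (by have := T.dist_far e; omega))

theorem exists_dist_le [Finite V] : ∃ N, ∀ v, T.graph.dist T.root v ≤ N := by
  obtain ⟨N, hN⟩ := (Set.finite_range (T.graph.dist T.root)).bddAbove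
  exact ⟨N, fun v => hN ⟨v, rfl⟩⟩

theorem exists_near_eq_root [Nonempty E] : ∃ e, T.near e = T.root := by
  by_contra! h
  obtain ⟨e⟩ := ‹Nonempty E›
  have hall : ∀ n e, n ≤ T.graph.dist T.root (T.near e) := by
    intro n
    induction n with
    | zero => exact fun _ => Nat.zero_le _
    | succ n ih =>
      intro e
      obtain ⟨e', he'⟩ := T.exists_far_eq (h e)
      rw [← he', T.dist_far]
      exact Nat.succ_le_succ (ih e')
  exact absurd (hall (T.graph.dist T.root (T.near e) + 1) e) (by omega)

/-- Induction from the leaves towards the root. -/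
theorem induction_up [Finite V] {P : V → Prop} (h : ∀ v, (∀ e, T.near e = v → P (T.far e)) → P v)
    (v : V) : P v := by
  obtain ⟨N, hN⟩ := T.exists_dist_le
  have key : ∀ n v, N + 1 ≤ T.graph.dist T.root v + n → P v := by
    intro n
    induction n with
    | zero => intro v hv; have := hN v; omega
    | succ n ih =>
      intro v hv
      refine h v fun e he => ih _ ?_
      have := T.dist_far e
      rw [he] at this
      omega
  exact key (N + 1) v (by omega)

/-- Recursion from the leaves towards the root. -/
theorem exists_recursion_up [Finite V] [DecidableEq V] [Fintype E] {Λ : Type*}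
    (G : E → Λ → ℝ → ℝ) :
    ∃ m : V → Λ → ℝ, ∀ v l, m v l = ∑ e with T.near e = v, G e l (m (T.far e) l) := by
  obtain ⟨N, hN⟩ := T.exists_dist_le
  let R : ℕ → V → Λ → ℝ := fun k => Nat.rec (fun _ _ => 0)
    (fun _ r v l => ∑ e with T.near e = v, G e l (r (T.far e) l)) k
  -- The start value `R 0` is arbitrary and need not agree with the empty sum at a leaf, so
  -- stabilization is claimed only from `R 1` on. At distance at least `N` no edge leads further
  -- out, so both sides are empty sums.
  have hR : ∀ k v, N ≤ T.graph.dist T.root v + k → R (k + 2) v = R (k + 1) v := by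
    intro k
    induction k with
    | zero =>
      intro v hv
      have hem : Finset.univ.filter (fun e => T.near e = v) = ∅ := by
        ext e
        simp only [Finset.mem_filter, Finset.mem_univ, true_and, Finset.notMem_empty, iff_false]
        rintro rfl
        have := T.dist_far e
        have := hN (T.far e)
        omega
      ext l
      change ∑ e with T.near e = v, G e l (R 1 (T.far e) l) =
        ∑ e with T.near e = v, G e l (R 0 (T.far e) l)
      simp only [hem, Finset.sum_empty]
    | succ k ih =>
      intro v hv
      ext l
      refine Finset.sum_congr rfl fun e he => ?_
      simp only [Finset.mem_filter, Finset.mem_univ, true_and] at he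
      have := T.dist_far e
      rw [he] at this
      exact congrArg (G e l) (congrFun (ih (T.far e) (by omega)) l)
  exact ⟨R (N + 1), fun v l => (congrFun (hR N v (by omega)) l).symm⟩

/-- Recursion from the root towards the leaves. -/
theorem exists_recursion_down [Fintype V] [Fintype E] (c : E → ℝ) :
    ∃ u : V → ℝ, u T.root = 1 ∧ ∀ e, u (T.far e) = c e * u (T.near e) := by
  classical
  have hinj := T.far_injective
  by_cases hE : Nonempty E
  · have hpar : ∀ v, v ≠ T.root → ∃ e, T.far e = v := fun v => T.exists_far_eq
    choose! par hpar using hpar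
    let R : ℕ → V → ℝ := fun k => Nat.rec (fun _ => 1)
      (fun _ r v => if v = T.root then 1 else c (par v) * r (T.near (par v))) k
    have hpar' : ∀ e, par (T.far e) = e := fun e => hinj (hpar _ (T.far_ne_root e))
    have hR : ∀ k v, T.graph.dist T.root v ≤ k → R (k + 1) v = R k v := by
      intro k
      induction k with
      | zero =>
        intro v hv
        have := T.isTree.connected.dist_eq_zero_iff.1 (Nat.le_zero.1 hv)
        simp [R, ← this]
      | succ k ih =>
        intro v hv
        by_cases hvr : v = T.root
        · simp [R, hvr]
        · obtain ⟨e, rfl⟩ := T.exists_far_eq hvr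
          have := T.dist_far e
          have := ih (T.near e) (by omega)
          simp only [R, hvr, if_false, hpar'] at this ⊢
          rw [this]
    obtain ⟨N, hN⟩ := T.exists_dist_le
    refine ⟨R (N + 1), by simp [R], fun e => ?_⟩
    have h1 : R (N + 1) (T.far e) = c e * R N (T.near e) := by
      simp [R, T.far_ne_root, hpar']
    rw [h1, hR N _ (hN _)]
  · exact ⟨fun _ => 1, rfl, fun e => (hE ⟨e⟩).elim⟩

/-- A solution `m` of the recursion for logarithmic derivatives gives vertex values `u`. -/
theorem exists_vertex_values [Fintype V] [DecidableEq V] [Fintype E] (m : V → ℝ)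
    (c s c' s' : E → ℝ) (hD : ∀ e, c e + m (T.far e) * s e ≠ 0)
    (hm : ∀ v, m v = ∑ e with T.near e = v,
      (c' e + m (T.far e) * s' e) / (c e + m (T.far e) * s e)) :
    ∃ u : V → ℝ, u T.root = 1 ∧
      (∀ e, u (T.far e) = (c e + m (T.far e) * s e)⁻¹ * u (T.near e)) ∧
      (∀ e, u (T.far e) * (c e + m (T.far e) * s e) = u (T.near e)) ∧
      (∀ v, ∑ e with T.near e = v, u (T.far e) * (c' e + m (T.far e) * s' e) = u v * m v) ∧
      (∀ v, v ≠ T.root → ∑ e with T.far e = v, u (T.far e) * m (T.far e) = u v * m v) := by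
  obtain ⟨u, hu0, hu⟩ := T.exists_recursion_down fun e => (c e + m (T.far e) * s e)⁻¹
  have hu' : ∀ e, u (T.far e) * (c e + m (T.far e) * s e) = u (T.near e) := fun e => by
    rw [hu e, mul_assoc, mul_comm (u _), ← mul_assoc, inv_mul_cancel₀ (hD e), one_mul]
  refine ⟨u, hu0, hu, hu', fun v => ?_, fun v hv => ?_⟩
  · rw [hm v, Finset.mul_sum]
    refine Finset.sum_congr rfl fun e he => ?_
    simp only [Finset.mem_filter, Finset.mem_univ, true_and] at he
    rw [← he, ← hu' e]
    field_simp [hD e]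
  · obtain ⟨e, rfl⟩ := T.exists_far_eq hv
    rw [T.filter_far_eq, Finset.sum_singleton]

end Tree
end RootedMetricTree

/-! ### Large eigenvalues of the zero potential -/

section

open Filter Topology

/-- Simultaneous Diophantine approximation: arbitrarily large common almost periods. -/
theorem exists_large_almost_period {E : Type*} [Fintype E] (a : E → ℝ) {η : ℝ} (hη : 0 < η)
    (S : ℝ) : ∃ s, S ≤ s ∧ ∃ k : E → ℤ, ∀ e, |s * a e - k e * (2 * Real.pi)| < η := by
  have : Fact (0 < 2 * Real.pi) := ⟨Real.two_pi_pos⟩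
  set R := max S 0
  let x : E → AddCircle (2 * Real.pi) := fun e => ((R * a e : ℝ) : AddCircle (2 * Real.pi))
  -- Recurrence in the compact torus: the multiples `n • x` return arbitrarily close to `0` for
  -- arbitrarily large `n`.
  have h := mapClusterPt_zero_atTop_nsmul x
  obtain ⟨n, hn, hn1⟩ := ((h.frequently (Metric.ball_mem_nhds 0 hη)).and_eventually
    (eventually_ge_atTop 1)).exists
  refine ⟨n * R, ?_, fun e => round ((2 * Real.pi)⁻¹ * (n * R * a e)), fun e => ?_⟩
  · have h1 : (1 : ℝ) ≤ n := by exact_mod_cast hn1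
    have h2 : 0 ≤ R := le_max_right _ _
    have h3 : S ≤ R := le_max_left _ _
    nlinarith
  · rw [dist_zero_right, pi_norm_lt_iff hη] at hn
    have := hn e
    rw [Pi.smul_apply, ← AddCircle.coe_nsmul, AddCircle.norm_eq, nsmul_eq_mul, ← mul_assoc] at this
    exact this

theorem isSturmLiouvilleSolution_cos_add_sin (a s A B : ℝ) :
    IsSturmLiouvilleSolution a 0 (s ^ 2) (fun x => A * Real.cos (s * x) + B * Real.sin (s * x))
      (fun x => A * (-s * Real.sin (s * x)) + B * (s * Real.cos (s * x))) := by
  have hs : ∀ x, HasDerivAt (fun x => Real.sin (s * x)) (s * Real.cos (s * x)) x := fun x => by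
    simpa [mul_comm] using ((hasDerivAt_id x).const_mul s).sin
  have hc : ∀ x, HasDerivAt (fun x => Real.cos (s * x)) (-s * Real.sin (s * x)) x := fun x => by
    simpa [mul_comm] using ((hasDerivAt_id x).const_mul s).cos
  refine IsSturmLiouvilleSolution.of_ae_hasDerivAt
    (fun x _ => (((hc x).const_mul A).add ((hs x).const_mul B)).hasDerivWithinAt) ?_
    (Eventually.of_forall fun x => ?_)
  · exact (by fun_prop : ContDiff ℝ 1 fun x => A * (-s * Real.sin (s * x)) +
      B * (s * Real.cos (s * x))).contDiffOn.absolutelyContinuousOnInterval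
  · convert! (((hs x).const_mul (-s)).const_mul A).add (((hc x).const_mul s).const_mul B) using 1
    simp only [Pi.zero_apply]
    ring

namespace RootedMetricTree

section ZeroPotential

variable {V E : Type*} [Fintype V] [DecidableEq V] [Fintype E] (T : RootedMetricTree V E)

/-- The logarithmic derivatives at the vertices for the zero potential, as functions of the
phases `θ e = s * len e`, near vanishing phases. -/
theorem exists_phase_recursion : ∃ m : V → (E → ℝ) → ℝ, ∃ δ > 0,
    (∀ v θ, m v θ = ∑ e with T.near e = v,
      (-Real.sin (θ e) + m (T.far e) θ * Real.cos (θ e)) /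
        (Real.cos (θ e) + m (T.far e) θ * Real.sin (θ e))) ∧
    (∀ θ, (∀ e, |θ e| < δ) → (∀ v, ContinuousAt (m v) θ) ∧
      ∀ e, 0 < Real.cos (θ e) + m (T.far e) θ * Real.sin (θ e)) ∧
    (∀ θ, (∀ e, |θ e| < δ) → (∀ e, 0 ≤ θ e) → ∀ v, m v θ ≤ 0) ∧
    (∀ θ, (∀ e, |θ e| < δ) → (∀ e, θ e ≤ 0) → ∀ v, 0 ≤ m v θ) := by
  -- On an edge, `cos + r sin` has value `1` and slope `r` at the far end, in units of `s`. The
  -- fraction is its logarithmic derivative at the near end, and Kirchhoff's condition adds these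
  -- up.
  obtain ⟨m, hm⟩ := T.exists_recursion_up (Λ := E → ℝ) fun e θ r =>
    (-Real.sin (θ e) + r * Real.cos (θ e)) / (Real.cos (θ e) + r * Real.sin (θ e))
  have hc : ∀ e (θ : E → ℝ), ContinuousAt (fun θ : E → ℝ => Real.cos (θ e)) θ := fun e θ =>
    (Real.continuous_cos.comp (continuous_apply e)).continuousAt
  have hs : ∀ e (θ : E → ℝ), ContinuousAt (fun θ : E → ℝ => Real.sin (θ e)) θ := fun e θ =>
    (Real.continuous_sin.comp (continuous_apply e)).continuousAt
  have hden : ∀ e, ContinuousAt (m (T.far e)) 0 →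
      ∀ᶠ θ in 𝓝 (0 : E → ℝ), 0 < Real.cos (θ e) + m (T.far e) θ * Real.sin (θ e) := by
    intro e he
    have : ContinuousAt (fun θ : E → ℝ => Real.cos (θ e) + m (T.far e) θ * Real.sin (θ e)) 0 :=
      (hc e 0).add (he.mul (hs e 0))
    exact this.eventually (lt_mem_nhds (by simp))
  have hcont : ∀ v, ∀ᶠ θ in 𝓝 (0 : E → ℝ), ContinuousAt (m v) θ := by
    refine T.induction_up fun v ih => ?_
    have h1 : ∀ᶠ θ in 𝓝 (0 : E → ℝ), ∀ e, T.near e = v → ContinuousAt (m (T.far e)) θ ∧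
        0 < Real.cos (θ e) + m (T.far e) θ * Real.sin (θ e) := by
      rw [eventually_all]
      intro e
      by_cases he : T.near e = v
      · filter_upwards [ih e he, hden e (ih e he).self_of_nhds] with θ h h' _ using ⟨h, h'⟩
      · exact Eventually.of_forall fun θ h => absurd h he
    filter_upwards [h1] with θ hθ
    rw [show m v = fun θ => ∑ e with T.near e = v,
      (-Real.sin (θ e) + m (T.far e) θ * Real.cos (θ e)) /
        (Real.cos (θ e) + m (T.far e) θ * Real.sin (θ e)) from funext (hm v)]
    refine tendsto_finsetSum _ fun e he => ?_
    obtain ⟨h, h'⟩ := hθ e (by simpa using he)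
    have hn : ContinuousAt (fun θ : E → ℝ =>
      -Real.sin (θ e) + m (T.far e) θ * Real.cos (θ e)) θ :=
      (hs e θ).neg.add (h.mul (hc e θ))
    have hd : ContinuousAt (fun θ : E → ℝ =>
      Real.cos (θ e) + m (T.far e) θ * Real.sin (θ e)) θ :=
      (hc e θ).add (h.mul (hs e θ))
    exact hn.div hd h'.ne'
  have hall : ∀ᶠ θ in 𝓝 (0 : E → ℝ), (∀ v, ContinuousAt (m v) θ) ∧
      ∀ e, 0 < Real.cos (θ e) + m (T.far e) θ * Real.sin (θ e) := by
    refine (eventually_all.2 hcont).and (eventually_all.2 fun e => ?_)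
    exact hden e (hcont (T.far e)).self_of_nhds
  obtain ⟨δ, hδ, hball⟩ := Metric.eventually_nhds_iff.1 hall
  -- The bound `1 < π / 2` keeps the cosines nonnegative and gives each sine the sign of its phase.
  have hball' : ∀ θ : E → ℝ, (∀ e, |θ e| < min δ 1) → (∀ v, ContinuousAt (m v) θ) ∧
      ∀ e, 0 < Real.cos (θ e) + m (T.far e) θ * Real.sin (θ e) := by
    intro θ hθ
    refine hball ?_
    rw [dist_zero_right, pi_norm_lt_iff hδ]
    exact fun e => (hθ e).trans_le (min_le_left _ _)
  have hpi := Real.pi_gt_three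
  have hcos : ∀ θ : E → ℝ, (∀ e, |θ e| < min δ 1) → ∀ e, 0 ≤ Real.cos (θ e) := by
    intro θ hθ e
    have := abs_lt.1 ((hθ e).trans_le (min_le_right _ _))
    exact Real.cos_nonneg_of_neg_pi_div_two_le_of_le (by linarith [this.1]) (by linarith [this.2])
  refine ⟨m, min δ 1, lt_min hδ one_pos, hm, hball', fun θ hθ hs => ?_, fun θ hθ hs => ?_⟩
  · refine T.induction_up fun v ih => ?_
    rw [hm]
    refine Finset.sum_nonpos fun e he => div_nonpos_of_nonpos_of_nonneg ?_ ((hball' θ hθ).2 e).le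
    have h1 := ih e (by simpa using he)
    have h2 := abs_lt.1 ((hθ e).trans_le (min_le_right _ _))
    have h3 := Real.sin_nonneg_of_nonneg_of_le_pi (hs e) (by linarith)
    have h4 := mul_nonpos_of_nonpos_of_nonneg h1 (hcos θ hθ e)
    linarith
  · refine T.induction_up fun v ih => ?_
    rw [hm]
    refine Finset.sum_nonneg fun e he => div_nonneg ?_ ((hball' θ hθ).2 e).le
    have h1 := ih e (by simpa using he)
    have h2 := abs_lt.1 ((hθ e).trans_le (min_le_right _ _))
    have h3 := Real.sin_nonpos_of_nonpos_of_neg_pi_le (hs e) (by linarith)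
    have h4 := mul_nonneg h1 (hcos θ hθ e)
    linarith

/-- The zero potential has arbitrarily large eigenvalues `s ^ 2` for which all the phases
`s * len e` are almost multiples of `2π`. -/
theorem exists_large_eigenvalue [Nonempty E] {η : ℝ} (hη : 0 < η) (S : ℝ) :
    ∃ s, S ≤ s ∧ s ^ 2 ∈ T.neumannSpectrum 0 ∧
      ∀ e, |Real.sin (s * T.len e)| ≤ η ∧ |Real.cos (s * T.len e) - 1| ≤ η := by
  obtain ⟨m, δ, hδ, hm, hreg, hneg, hpos⟩ := T.exists_phase_recursion
  set ρ := min δ η with hρ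
  have hρ0 : 0 < ρ := lt_min hδ hη
  obtain ⟨t, ht0, ht⟩ : ∃ t > 0, ∀ e, t * T.len e < ρ / 2 := by
    have : ∀ᶠ t in 𝓝[>] (0 : ℝ), ∀ e, t * T.len e < ρ / 2 := by
      rw [eventually_all]
      intro e
      have : Tendsto (fun t : ℝ => t * T.len e) (𝓝[>] 0) (𝓝 0) := by
        have h : Continuous fun t : ℝ => t * T.len e := by fun_prop
        simpa using (h.tendsto 0).mono_left nhdsWithin_le_nhds
      exact this.eventually (gt_mem_nhds (half_pos hρ0))
    obtain ⟨t, h1, h2⟩ := (this.and self_mem_nhdsWithin).exists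
    exact ⟨t, h2, h1⟩
  -- The approximation error `ε` is smaller than every `t * len e`, so a shift of `s` by `t` or `-t`
  -- makes all phases positive or all negative, with total size still below `ρ`.
  obtain ⟨ε, hε0, hε⟩ : ∃ ε > 0, ε < ρ / 2 ∧ ∀ e, ε < t * T.len e := by
    have : ∀ᶠ ε in 𝓝[>] (0 : ℝ), ε < ρ / 2 ∧ ∀ e, ε < t * T.len e := by
      refine Eventually.and ?_ (eventually_all.2 fun e => ?_)
      · exact nhdsWithin_le_nhds (gt_mem_nhds (half_pos hρ0))
      · exact nhdsWithin_le_nhds (gt_mem_nhds (mul_pos ht0 (T.len_pos e)))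
    obtain ⟨t, h1, h2⟩ := (this.and self_mem_nhdsWithin).exists
    exact ⟨t, h2, h1⟩
  obtain ⟨s₀, hs₀, k, hk⟩ := exists_large_almost_period T.len hε0 (max S 1 + t)
  set Θ : ℝ → E → ℝ := fun τ e => s₀ * T.len e - k e * (2 * Real.pi) + τ * T.len e with hΘ
  have hΘb : ∀ τ ∈ Icc (-t) t, ∀ e, |Θ τ e| < ρ := by
    intro τ hτ e
    have h1 : |τ * T.len e| ≤ t * T.len e := by
      rw [abs_mul, abs_of_pos (T.len_pos e)]
      exact mul_le_mul_of_nonneg_right (abs_le.2 hτ) (T.len_pos e).le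
    calc |Θ τ e| ≤ |s₀ * T.len e - k e * (2 * Real.pi)| + |τ * T.len e| := abs_add_le _ _
      _ < ρ := by linarith [hk e, ht e, hε.1]
  have hΘδ : ∀ τ ∈ Icc (-t) t, ∀ e, |Θ τ e| < δ := fun τ hτ e =>
    (hΘb τ hτ e).trans_le (min_le_left _ _)
  have hΘc : Continuous Θ := by fun_prop
  have hF : ContinuousOn (fun τ => m T.root (Θ τ)) (Icc (-t) t) := fun τ hτ =>
    (ContinuousAt.comp (f := Θ) ((hreg _ (hΘδ τ hτ)).1 T.root) hΘc.continuousAt).continuousWithinAt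
  have htt : -t ≤ t := by linarith
  -- A zero of the logarithmic derivative at the root is the one remaining Kirchhoff condition; the
  -- two sign statements supply the sign change.
  obtain ⟨τ, hτ, hτ0⟩ : ∃ τ ∈ Icc (-t) t, m T.root (Θ τ) = 0 := by
    refine intermediate_value_Icc' htt hF ⟨?_, ?_⟩
    · refine hneg _ (hΘδ t (right_mem_Icc.2 htt)) (fun e => ?_) _
      have := (abs_lt.1 (hk e)).1
      simp only [hΘ]; linarith [hε.2 e]
    · refine hpos _ (hΘδ (-t) (left_mem_Icc.2 htt)) (fun e => ?_) _
      have := (abs_lt.1 (hk e)).2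
      simp only [hΘ]; linarith [hε.2 e]
  set s := s₀ + τ with hs
  have hsθ : ∀ e, s * T.len e = Θ τ e + k e * (2 * Real.pi) := fun e => by simp only [hΘ, hs]; ring
  have hsin : ∀ e, Real.sin (s * T.len e) = Real.sin (Θ τ e) := fun e => by
    rw [hsθ, Real.sin_add_int_mul_two_pi]
  have hcos : ∀ e, Real.cos (s * T.len e) = Real.cos (Θ τ e) := fun e => by
    rw [hsθ, Real.cos_add_int_mul_two_pi]
  have hSs : S ≤ s := by have := le_max_left S 1; linarith [hτ.1]
  refine ⟨s, hSs, ?_, fun e => ?_⟩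
  · obtain ⟨u, hu0, huinv, hun, hunear, hufar⟩ := T.exists_vertex_values (fun v => m v (Θ τ))
      (fun e => Real.cos (Θ τ e)) (fun e => Real.sin (Θ τ e))
      (fun e => -Real.sin (Θ τ e)) (fun e => Real.cos (Θ τ e))
      (fun e => ((hreg _ (hΘδ τ hτ)).2 e).ne') (fun v => hm v _)
    have hune : ∀ v, u v ≠ 0 := T.induction_down (by simp [hu0]) fun e he => by
      rw [huinv]
      exact mul_ne_zero (inv_ne_zero ((hreg _ (hΘδ τ hτ)).2 e).ne') he
    refine ⟨_, _, ⟨fun e => isSturmLiouvilleSolution_cos_add_sin (T.len e) s (u (T.far e))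
      (u (T.far e) * m (T.far e) (Θ τ)), ⟨u, fun e => ⟨by simp, ?_⟩⟩, fun v => ?_⟩, ?_⟩
    · simp only [hsin, hcos]
      rw [← hun e]
      ring
    · have h1 : ∑ e with T.near e = v, (u (T.far e) * (-s * Real.sin (s * T.len e)) +
          u (T.far e) * m (T.far e) (Θ τ) * (s * Real.cos (s * T.len e))) =
          s * (u v * m v (Θ τ)) := by
        rw [← hunear v, Finset.mul_sum]
        refine Finset.sum_congr rfl fun e _ => ?_
        rw [hsin, hcos]
        ring
      refine h1.trans ?_
      by_cases hv : v = T.root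
      · rw [hv, T.filter_far_root, hτ0]
        simp
      · rw [← hufar v hv, Finset.mul_sum]
        refine Finset.sum_congr rfl fun e _ => ?_
        simp
        ring
    · obtain ⟨e⟩ := ‹Nonempty E›
      exact ⟨e, 0, left_mem_Icc.2 (T.len_pos e).le, by simpa using hune _⟩
  · have h1 : |Θ τ e| < η := (hΘb τ hτ e).trans_le (min_le_right _ _)
    rw [hsin, hcos]
    refine ⟨Real.abs_sin_le_abs.trans h1.le, ?_⟩
    have h2 := Real.lipschitzWith_cos.dist_le_mul (Θ τ e) 0
    rw [Real.dist_eq, Real.dist_eq, Real.cos_zero, sub_zero, NNReal.coe_one, one_mul] at h2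
    exact h2.trans h1.le

end ZeroPotential
end RootedMetricTree

/-! ### High-energy asymptotics and the mean of the potential -/

/-- Riemann-Lebesgue: `cos²` averages to one half. -/
theorem tendsto_integral_mul_cos_sq {a : ℝ} (ha : 0 ≤ a) {q : ℝ → ℝ}
    (hq : IntegrableOn q (Icc 0 a)) :
    Tendsto (fun s : ℝ => ∫ t in (0 : ℝ)..a, q t * Real.cos (s * t) ^ 2) atTop
      (𝓝 ((∫ t in (0 : ℝ)..a, q t) / 2)) := by
  have hqi : IntervalIntegrable q volume 0 a := by
    rw [intervalIntegrable_iff_integrableOn_Icc_of_le ha]; exact hq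
  have hcos : Tendsto (fun s : ℝ => ∫ t in (0 : ℝ)..a, q t * Real.cos (2 * s * t)) atTop
      (𝓝 0) := by
    set f : ℝ → ℂ := (Ioc 0 a).indicator fun t => (q t : ℂ) with hf
    have h1 := (Real.tendsto_integral_exp_smul_cocompact f).mono_left atTop_le_cocompact
    -- The Fourier kernel is `exp (-2πi v w)`, so the frequency `w = s / π` produces `cos (2 s v)`.
    have h2 : Tendsto (fun s : ℝ => s / Real.pi) atTop atTop :=
      tendsto_id.atTop_div_const Real.pi_pos
    have h3 := (Complex.continuous_re.tendsto 0).comp (h1.comp h2)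
    refine h3.congr fun s => ?_
    have hint : Integrable fun v : ℝ => Real.fourierChar (-(v * (s / Real.pi))) • f v := by
      have hfi : Integrable f := by
        rw [hf, integrable_indicator_iff measurableSet_Ioc]
        exact ((intervalIntegrable_iff_integrableOn_Ioc_of_le ha).1 hqi).ofReal
      have := (Real.fourierIntegral_convergent_iff (μ := volume) (f := f) (s / Real.pi)).2 hfi
      simpa [mul_comm] using this
    simp only [Function.comp_apply]
    rw [show (∫ v : ℝ, Real.fourierChar (-(v * (s / Real.pi))) • f v).re =
      ∫ v : ℝ, (Real.fourierChar (-(v * (s / Real.pi))) • f v).re from (integral_re hint).symm,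
      intervalIntegral.integral_of_le ha, ← integral_indicator measurableSet_Ioc]
    congr 1
    ext v
    by_cases hv : v ∈ Ioc 0 a
    · simp only [hf, indicator_of_mem hv, Circle.smul_def, Real.fourierChar_apply, smul_eq_mul]
      rw [Complex.re_mul_ofReal, Complex.exp_ofReal_mul_I_re, mul_comm (q v), ← Real.cos_neg]
      congr 2
      field_simp
    · simp [hf, indicator_of_notMem hv]
  have h := (tendsto_const_nhds (x := (∫ t in (0 : ℝ)..a, q t) / 2)).add (hcos.div_const 2)
  rw [zero_div, add_zero] at h
  refine h.congr fun s => ?_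
  rw [← add_div, ← intervalIntegral.integral_add hqi
    (hqi.mul_continuousOn (by fun_prop)), ← intervalIntegral.integral_div]
  congr 1
  ext t
  rw [Real.cos_sq]
  ring_nf

namespace IsSturmLiouvilleSolution

variable {a s : ℝ} {q y dy : ℝ → ℝ}

/-- Green's identity against a free solution at the same `s ^ 2`: only `q` survives in the
integrand, multiplied by two factors bounded by `1`. -/
theorem abs_green_trig_le (ha : 0 ≤ a) (hq : IntegrableOn q (Icc 0 a))
    (hy : IsSturmLiouvilleSolution a q (s ^ 2) y dy) (hb : ∀ x ∈ Icc 0 a, |y x| ≤ 1)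
    {A B : ℝ} (hAB : ∀ t, |A * Real.cos (s * t) + B * Real.sin (s * t)| ≤ 1)
    {x : ℝ} (hx : x ∈ Icc 0 a) :
    |(dy x * (A * Real.cos (s * x) + B * Real.sin (s * x)) -
      y x * (A * (-s * Real.sin (s * x)) + B * (s * Real.cos (s * x)))) -
      (dy 0 * A - y 0 * (B * s))| ≤ ∫ t in (0 : ℝ)..a, |q t| := by
  have h := hy.green ha (isSturmLiouvilleSolution_cos_add_sin a s A B) hx
  simp only [mul_zero, Real.cos_zero, Real.sin_zero, mul_one, add_zero, zero_add,
    Pi.zero_apply] at h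
  rw [← h]
  have hqi : IntervalIntegrable q volume 0 a := by
    rw [intervalIntegrable_iff_integrableOn_Icc_of_le ha]; exact hq
  have hsub : uIcc 0 x ⊆ uIcc 0 a := by
    rw [uIcc_of_le ha, uIcc_of_le hx.1]; exact Icc_subset_Icc_right hx.2
  have h1 : ∀ t ∈ Icc 0 x, ‖(q t - s ^ 2 - (0 - s ^ 2)) * y t *
      (A * Real.cos (s * t) + B * Real.sin (s * t))‖ ≤ |q t| := by
    intro t ht
    rw [norm_mul, norm_mul, Real.norm_eq_abs, Real.norm_eq_abs, Real.norm_eq_abs,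
      show q t - s ^ 2 - (0 - s ^ 2) = q t by ring, mul_assoc]
    have := mul_le_one₀ (hb t ⟨ht.1, ht.2.trans hx.2⟩) (abs_nonneg _) (hAB t)
    exact mul_le_of_le_one_right (abs_nonneg _) this
  calc |∫ t in (0 : ℝ)..x, (q t - s ^ 2 - (0 - s ^ 2)) * y t *
        (A * Real.cos (s * t) + B * Real.sin (s * t))| ≤ ∫ t in (0 : ℝ)..x, |q t| := by
        refine intervalIntegral.norm_integral_le_of_norm_le (E := ℝ) hx.1 ?_ (hqi.mono_set hsub).abs
        exact Eventually.of_forall fun t ht => h1 t (Ioc_subset_Icc_self ht)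
    _ ≤ _ := intervalIntegral.integral_mono_interval le_rfl hx.1 hx.2
        (Eventually.of_forall fun _ => abs_nonneg _) hqi.abs

/-- The test solution `t ↦ sin (s (x - t))` vanishes at `t = x` with slope `-s`, which isolates `y
x`. -/
theorem abs_sub_trig_le (ha : 0 ≤ a) (hs : 0 < s) (hq : IntegrableOn q (Icc 0 a))
    (hy : IsSturmLiouvilleSolution a q (s ^ 2) y dy) (hb : ∀ x ∈ Icc 0 a, |y x| ≤ 1)
    {x : ℝ} (hx : x ∈ Icc 0 a) :
    |y x - (y 0 * Real.cos (s * x) + dy 0 / s * Real.sin (s * x))| ≤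
      (∫ t in (0 : ℝ)..a, |q t|) / s := by
  have h := hy.abs_green_trig_le ha hq hb (A := Real.sin (s * x)) (B := -Real.cos (s * x))
    (fun t => by
      rw [show Real.sin (s * x) * Real.cos (s * t) + -Real.cos (s * x) * Real.sin (s * t) =
        Real.sin (s * x - s * t) by rw [Real.sin_sub]; ring]
      exact Real.abs_sin_le_one _) hx
  rw [le_div_iff₀ hs]
  refine le_trans (le_of_eq ?_) h
  rw [← abs_of_pos hs, ← abs_mul, abs_of_pos hs]
  congr 1
  have := Real.sin_sq_add_cos_sq (s * x)
  field_simp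
  linear_combination (-s * y x) * this

/-- The test solution `t ↦ cos (s (x - t))` has value `1` and slope `0` at `t = x`, which isolates
`dy x`. -/
theorem abs_deriv_sub_trig_le (ha : 0 ≤ a) (hs : 0 < s) (hq : IntegrableOn q (Icc 0 a))
    (hy : IsSturmLiouvilleSolution a q (s ^ 2) y dy) (hb : ∀ x ∈ Icc 0 a, |y x| ≤ 1)
    {x : ℝ} (hx : x ∈ Icc 0 a) :
    |dy x / s - (-(y 0 * Real.sin (s * x)) + dy 0 / s * Real.cos (s * x))| ≤
      (∫ t in (0 : ℝ)..a, |q t|) / s := by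
  have h := hy.abs_green_trig_le ha hq hb (A := Real.cos (s * x)) (B := Real.sin (s * x))
    (fun t => by
      rw [← Real.cos_sub]
      exact Real.abs_cos_le_one _) hx
  rw [le_div_iff₀ hs]
  refine le_trans (le_of_eq ?_) h
  rw [← abs_of_pos hs, ← abs_mul, abs_of_pos hs]
  congr 1
  have := Real.sin_sq_add_cos_sq (s * x)
  field_simp
  linear_combination (-dy x) * this

end IsSturmLiouvilleSolution

namespace RootedMetricTree

section Asymptotics

variable {V E : Type*} [DecidableEq V] [Fintype E] (T : RootedMetricTree V E)
  {Q : E → ℝ → ℝ} {lam : ℝ} {y dy : E → ℝ → ℝ}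

/-- Boundary terms are regrouped by vertex, where Kirchhoff's condition makes each bracket vanish.
-/
theorem sum_edges_eq_sum_vertices [Fintype V] (f g : E → ℝ) (w : V → ℝ) :
    ∑ e, (f e * w (T.near e) - g e * w (T.far e)) =
      ∑ v, w v * (∑ e with T.near e = v, f e - ∑ e with T.far e = v, g e) := by
  rw [Finset.sum_sub_distrib, ← Finset.sum_fiberwise Finset.univ T.near,
    ← Finset.sum_fiberwise (f := fun e => g e * w (T.far e)) Finset.univ T.far,
    ← Finset.sum_sub_distrib]
  refine Finset.sum_congr rfl fun v _ => ?_
  rw [mul_sub, Finset.mul_sum, Finset.mul_sum]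
  congr 1 <;>
  · refine Finset.sum_congr rfl fun e he => ?_
    rw [(Finset.mem_filter.1 he).2, mul_comm]

variable {T}

theorem IsNeumannSolution.const_mul (h : T.IsNeumannSolution Q lam y dy) (c : ℝ) :
    T.IsNeumannSolution Q lam (fun e x => c * y e x) (fun e x => c * dy e x) where
  solution e := (h.solution e).const_mul c
  continuity := by
    obtain ⟨u, hu⟩ := h.continuity
    exact ⟨fun v => c * u v, fun e => ⟨by rw [(hu e).1], by rw [(hu e).2]⟩⟩
  kirchhoff v := by rw [← Finset.mul_sum, ← Finset.mul_sum, h.kirchhoff v]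

theorem exists_normalized_of_mem_neumannSpectrum (h : lam ∈ T.neumannSpectrum Q) :
    ∃ y dy, T.IsNeumannSolution Q lam y dy ∧ (∀ e, ∀ x ∈ Icc 0 (T.len e), |y e x| ≤ 1) ∧
      ∃ e, ∃ x ∈ Icc 0 (T.len e), |y e x| = 1 := by
  obtain ⟨y, dy, hN, e₀, x₀, hx₀, hne⟩ := h
  have : Nonempty E := ⟨e₀⟩
  have hmax : ∀ e, ∃ x ∈ Icc 0 (T.len e), ∀ x' ∈ Icc 0 (T.len e), |y e x'| ≤ |y e x| := fun e =>
    isCompact_Icc.exists_isMaxOn ⟨0, left_mem_Icc.2 (T.len_pos e).le⟩ (hN.solution e).continuousOn.abs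
  choose X hX hXmax using hmax
  obtain ⟨e₁, he₁⟩ := Finite.exists_max fun e => |y e (X e)|
  have hb : ∀ e, ∀ x ∈ Icc 0 (T.len e), |y e x| ≤ |y e₁ (X e₁)| := fun e x hx =>
    (hXmax e x hx).trans (he₁ e)
  have hpos : 0 < |y e₁ (X e₁)| := (abs_pos.2 hne).trans_le (hb e₀ x₀ hx₀)
  refine ⟨_, _, hN.const_mul |y e₁ (X e₁)|⁻¹, fun e x hx => ?_, e₁, X e₁, hX e₁, ?_⟩
  · rw [abs_mul, abs_inv, abs_abs, inv_mul_le_iff₀ hpos, mul_one]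
    exact hb e x hx
  · rw [abs_mul, abs_inv, abs_abs, inv_mul_cancel₀ hpos.ne']

/-- Along large spectral parameters for which all phases `s * len e` tend to `0` modulo `2π`,
suitably normalized eigenfunctions are uniformly close to `cos (s * x)`. -/
theorem eventually_exists_close_to_cos [Fintype V]
    (hQ : ∀ e, IntegrableOn (Q e) (Icc 0 (T.len e))) {s : ℕ → ℝ} (hs : Tendsto s atTop atTop)
    (hsin : ∀ e, Tendsto (fun n => Real.sin (s n * T.len e)) atTop (𝓝 0))
    (hcos : ∀ e, Tendsto (fun n => Real.cos (s n * T.len e)) atTop (𝓝 1))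
    (hmem : ∀ n, s n ^ 2 ∈ T.neumannSpectrum Q) {ε : ℝ} (hε : 0 < ε) :
    ∀ᶠ n in atTop, ∃ y dy, T.IsNeumannSolution Q (s n ^ 2) y dy ∧
      ∀ e, ∀ x ∈ Icc 0 (T.len e), |y e x - Real.cos (s n * x)| ≤ ε := by
  choose y dy hN hb e₁ x₁ hx₁ hat using fun n => exists_normalized_of_mem_neumannSpectrum (hmem n)
  choose u hu using fun n => (hN n).continuity
  set K : E → ℝ := fun e => ∫ t in (0 : ℝ)..(T.len e), |Q e t| with hK
  have hspos : ∀ᶠ n in atTop, 0 < s n := hs.eventually_gt_atTop 0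
  have hKs : ∀ e, Tendsto (fun n => K e / s n) atTop (𝓝 0) := fun e => hs.const_div_atTop _
  have h0 : ∀ e, (0 : ℝ) ∈ Icc 0 (T.len e) := fun e => left_mem_Icc.2 (T.len_pos e).le
  have hl : ∀ e, T.len e ∈ Icc 0 (T.len e) := fun e => right_mem_Icc.2 (T.len_pos e).le
  have hy0 : ∀ e, IsBoundedUnder (· ≤ ·) atTop (norm ∘ fun n => y n e 0) := fun e =>
    isBoundedUnder_of ⟨1, fun n => hb n e 0 (h0 e)⟩
  have hys : ∀ e, Tendsto (fun n => y n e 0 * Real.sin (s n * T.len e)) atTop (𝓝 0) := fun e =>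
    isBoundedUnder_le_mul_tendsto_zero (hy0 e) (hsin e)
  -- From the leaves inwards: Kirchhoff's condition expresses the scaled slope at a far end by
  -- slopes at the near ends of the edges beyond it, and these tend to `0` by the trigonometric
  -- asymptotics.
  have hβ : ∀ v e, T.far e = v → Tendsto (fun n => dy n e 0 / s n) atTop (𝓝 0) := by
    refine T.induction_up fun v ih e he => ?_
    subst he
    have hK1 : ∀ n, dy n e 0 / s n = ∑ e' with T.near e' = T.far e, dy n e' (T.len e') / s n := by
      intro n
      rw [← Finset.sum_div, (hN n).kirchhoff, T.filter_far_eq, Finset.sum_singleton]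
    simp_rw [hK1]
    rw [show (0 : ℝ) = ∑ e' with T.near e' = T.far e, 0 by simp]
    refine tendsto_finsetSum _ fun e' he' => ?_
    have hβ' := ih e' (Finset.mem_filter.1 he').2 e' rfl
    have h1 : Tendsto (fun n => dy n e' (T.len e') / s n -
        (-(y n e' 0 * Real.sin (s n * T.len e')) +
          dy n e' 0 / s n * Real.cos (s n * T.len e'))) atTop (𝓝 0) := by
      refine squeeze_zero_norm' ?_ (hKs e')
      filter_upwards [hspos] with n hn
      exact ((hN n).solution e').abs_deriv_sub_trig_le (T.len_pos e').le hn (hQ e') (hb n e') (hl e')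
    have h2 := h1.add ((hys e').neg.add (hβ'.mul (hcos e')))
    simpa using h2
  have huv : ∀ e, Tendsto (fun n => u n (T.far e) - u n (T.near e)) atTop (𝓝 0) := by
    intro e
    have h1 : Tendsto (fun n => y n e (T.len e) -
        (y n e 0 * Real.cos (s n * T.len e) +
          dy n e 0 / s n * Real.sin (s n * T.len e))) atTop (𝓝 0) := by
      refine squeeze_zero_norm' ?_ (hKs e)
      filter_upwards [hspos] with n hn
      exact ((hN n).solution e).abs_sub_trig_le (T.len_pos e).le hn (hQ e) (hb n e) (hl e)
    have h2 : Tendsto (fun n => y n e 0 * (Real.cos (s n * T.len e) - 1)) atTop (𝓝 0) :=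
      isBoundedUnder_le_mul_tendsto_zero (hy0 e) (by simpa using (hcos e).sub_const 1)
    have h3 := ((h1.add h2).add ((hβ _ e rfl).mul (hsin e))).neg
    simp only [add_zero, mul_zero, neg_zero] at h3
    refine h3.congr fun n => ?_
    rw [← (hu n e).1, ← (hu n e).2]
    ring
  have hroot : ∀ v, Tendsto (fun n => u n v - u n T.root) atTop (𝓝 0) :=
    T.induction_down (by simp) fun e he => by simpa using (huv e).add he
  set r : ℕ → E → ℝ := fun n e => |u n (T.far e) - u n T.root| + |dy n e 0 / s n| + K e / s n with hr
  have hr0 : ∀ e, Tendsto (fun n => r n e) atTop (𝓝 0) := fun e => by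
    simpa using ((hroot (T.far e)).abs.add (hβ _ e rfl).abs).add (hKs e)
  have hest : ∀ᶠ n in atTop, ∀ e, ∀ x ∈ Icc 0 (T.len e),
      |y n e x - u n T.root * Real.cos (s n * x)| ≤ r n e := by
    filter_upwards [hspos] with n hn e x hx
    have h1 := ((hN n).solution e).abs_sub_trig_le (T.len_pos e).le hn (hQ e) (hb n e) hx
    rw [(hu n e).1] at h1
    have h2 : |(u n (T.far e) - u n T.root) * Real.cos (s n * x)| ≤ |u n (T.far e) - u n T.root| := by
      rw [abs_mul]
      exact mul_le_of_le_one_right (abs_nonneg _) (Real.abs_cos_le_one _)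
    have h3 : |dy n e 0 / s n * Real.sin (s n * x)| ≤ |dy n e 0 / s n| := by
      rw [abs_mul]
      exact mul_le_of_le_one_right (abs_nonneg _) (Real.abs_sin_le_one _)
    calc |y n e x - u n T.root * Real.cos (s n * x)|
        = |(u n (T.far e) - u n T.root) * Real.cos (s n * x) +
          dy n e 0 / s n * Real.sin (s n * x) +
          (y n e x - (u n (T.far e) * Real.cos (s n * x) +
            dy n e 0 / s n * Real.sin (s n * x)))| := by congr 1; ring
      _ ≤ _ := (abs_add_three _ _ _).trans (by simp only [hr]; gcongr)
  -- The bound `1 / 2`, used where `|y| = 1`, gives `|u root| ≥ 1 / 2`; dividing by `u root` then at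
  -- most doubles the error, whence `ε / 2`.
  have hsmall : ∀ᶠ n in atTop, ∀ e, r n e < min (ε / 2) (1 / 2) :=
    eventually_all.2 fun e => (hr0 e).eventually (gt_mem_nhds (by positivity))
  filter_upwards [hest, hsmall] with n hest hsmall
  have hur : 1 / 2 ≤ |u n T.root| := by
    have h1 := hest (e₁ n) (x₁ n) (hx₁ n)
    have h2 := (hsmall (e₁ n)).trans_le (min_le_right _ _)
    have h3 := abs_sub_abs_le_abs_sub (y n (e₁ n) (x₁ n)) (u n T.root * Real.cos (s n * x₁ n))
    rw [hat n, abs_mul] at h3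
    have h4 := mul_le_of_le_one_right (abs_nonneg (u n T.root)) (Real.abs_cos_le_one (s n * x₁ n))
    linarith
  have hne : u n T.root ≠ 0 := abs_pos.1 (by linarith)
  refine ⟨_, _, (hN n).const_mul (u n T.root)⁻¹, fun e x hx => ?_⟩
  have h1 := (hest e x hx).trans ((hsmall e).le.trans (min_le_left _ _))
  rw [show (u n T.root)⁻¹ * y n e x - Real.cos (s n * x) =
    (y n e x - u n T.root * Real.cos (s n * x)) / u n T.root by field_simp, abs_div,
    div_le_iff₀ (by linarith)]
  nlinarith

/-- Orthogonality relation between eigenfunctions for two potentials. -/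
theorem IsNeumannSolution.sum_integral_eq_zero [Fintype V] {Q' : E → ℝ → ℝ} {z dz : E → ℝ → ℝ}
    (hy : T.IsNeumannSolution Q lam y dy) (hz : T.IsNeumannSolution Q' lam z dz) :
    ∑ e, ∫ t in (0 : ℝ)..(T.len e), (Q e t - Q' e t) * y e t * z e t = 0 := by
  obtain ⟨u, hu⟩ := hy.continuity
  obtain ⟨w, hw⟩ := hz.continuity
  have h1 : ∀ e, ∫ t in (0 : ℝ)..(T.len e), (Q e t - Q' e t) * y e t * z e t =
      (dy e (T.len e) * w (T.near e) - dy e 0 * w (T.far e)) -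
      (dz e (T.len e) * u (T.near e) - dz e 0 * u (T.far e)) := by
    intro e
    have := (hy.solution e).green (T.len_pos e).le (hz.solution e) (right_mem_Icc.2 (T.len_pos e).le)
    simp only [sub_sub_sub_cancel_right] at this
    rw [this, (hu e).1, (hu e).2, (hw e).1, (hw e).2]
    ring
  simp_rw [h1]
  rw [Finset.sum_sub_distrib, T.sum_edges_eq_sum_vertices, T.sum_edges_eq_sum_vertices]
  simp [hy.kirchhoff, hz.kirchhoff]

theorem sum_integral_eq_zero_of_neumannSpectrum_eq [Fintype V] [Nonempty E]
    (hQ : ∀ e, IntegrableOn (Q e) (Icc 0 (T.len e)))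
    (hspec : T.neumannSpectrum Q = T.neumannSpectrum 0) :
    ∑ e, ∫ t in (0 : ℝ)..(T.len e), Q e t = 0 := by
  choose s hs hmem htrig using fun n : ℕ =>
    T.exists_large_eigenvalue (η := 1 / ((n : ℝ) + 1)) (by positivity) n
  have hlim : Tendsto (fun n : ℕ => 1 / ((n : ℝ) + 1)) atTop (𝓝 0) :=
    tendsto_one_div_add_atTop_nhds_zero_nat
  have hs' : Tendsto s atTop atTop := tendsto_atTop_mono hs tendsto_natCast_atTop_atTop
  have hsin : ∀ e, Tendsto (fun n => Real.sin (s n * T.len e)) atTop (𝓝 0) := fun e =>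
    squeeze_zero_norm (fun n => (htrig n e).1) hlim
  have hcos : ∀ e, Tendsto (fun n => Real.cos (s n * T.len e)) atTop (𝓝 1) := fun e => by
    have := squeeze_zero_norm (f := fun n => Real.cos (s n * T.len e) - 1)
      (fun n => (htrig n e).2) hlim
    simpa using this.add_const 1
  set K := ∑ e, ∫ t in (0 : ℝ)..(T.len e), |Q e t| with hK
  have hqi : ∀ e, IntervalIntegrable (Q e) volume 0 (T.len e) := fun e => by
    rw [intervalIntegrable_iff_integrableOn_Icc_of_le (T.len_pos e).le]; exact hQ e
  have hhalf : Tendsto (fun n => ∑ e, ∫ t in (0 : ℝ)..(T.len e), Q e t * Real.cos (s n * t) ^ 2)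
      atTop (𝓝 (∑ e, (∫ t in (0 : ℝ)..(T.len e), Q e t) / 2)) :=
    tendsto_finsetSum _ fun e _ =>
      (tendsto_integral_mul_cos_sq (T.len_pos e).le (hQ e)).comp hs'
  -- With `c = cos (s t)`, `y z - c² = (y - c) c + (z - c) c + (y - c)(z - c)`. Each of the three
  -- terms is at most `ε`, the last because `ε ≤ 1`.
  have hbound : ∀ ε > 0, ε ≤ 1 →
      |∑ e, (∫ t in (0 : ℝ)..(T.len e), Q e t) / 2| ≤ 3 * ε * K := by
    intro ε hε hε1
    refine le_of_tendsto hhalf.abs ?_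
    filter_upwards [eventually_exists_close_to_cos hQ hs' hsin hcos
      (fun n => hspec ▸ hmem n) hε, eventually_exists_close_to_cos (Q := 0)
      (fun e => integrableOn_zero) hs' hsin hcos hmem hε]
      with n ⟨y, dy, hy, hyc⟩ ⟨z, dz, hz, hzc⟩
    have h0 := hy.sum_integral_eq_zero hz
    simp only [Pi.zero_apply, sub_zero] at h0
    -- Orthogonality is recast as `X - 0 = X`, so that the cosine sum `X` can be replaced by its
    -- difference from the vanishing sum.
    rw [← sub_eq_self (a := ∑ e, ∫ t in (0 : ℝ)..(T.len e), Q e t * Real.cos (s n * t) ^ 2)] at h0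
    rw [← h0, ← Finset.sum_sub_distrib, hK, Finset.mul_sum]
    refine (Finset.abs_sum_le_sum_abs _ _).trans (Finset.sum_le_sum fun e _ => ?_)
    have hyz : ContinuousOn (fun t => y e t * z e t) (uIcc 0 (T.len e)) := by
      rw [uIcc_of_le (T.len_pos e).le]
      exact (hy.solution e).continuousOn.mul (hz.solution e).continuousOn
    have hi1 : IntervalIntegrable (fun t => Q e t * y e t * z e t) volume 0 (T.len e) := by
      simpa only [mul_assoc] using (hqi e).mul_continuousOn hyz
    rw [← intervalIntegral.integral_sub ((hqi e).mul_continuousOn (by fun_prop)) hi1,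
      ← intervalIntegral.integral_const_mul]
    refine intervalIntegral.norm_integral_le_of_norm_le (E := ℝ) (T.len_pos e).le
      (Eventually.of_forall fun t ht => ?_) ((hqi e).abs.const_mul _)
    have hc := Real.abs_cos_le_one (s n * t)
    have h1 := hyc e t (Ioc_subset_Icc_self ht)
    have h2 := hzc e t (Ioc_subset_Icc_self ht)
    set c := Real.cos (s n * t)
    rw [show Q e t * c ^ 2 - Q e t * y e t * z e t =
      -(Q e t * ((y e t - c) * c + (z e t - c) * c + (y e t - c) * (z e t - c))) by ring,
      norm_neg, norm_mul, Real.norm_eq_abs, Real.norm_eq_abs, mul_comm]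
    gcongr
    refine (abs_add_three _ _ _).trans ?_
    rw [abs_mul, abs_mul, abs_mul]
    have h3 : |y e t - c| * |c| ≤ ε * 1 := by gcongr
    have h4 : |z e t - c| * |c| ≤ ε * 1 := by gcongr
    have h5 : |y e t - c| * |z e t - c| ≤ ε * 1 := by
      gcongr
      exact h2.trans hε1
    linarith
  have hzero : |∑ e, (∫ t in (0 : ℝ)..(T.len e), Q e t) / 2| ≤ 0 := by
    refine ge_of_tendsto (f := fun ε : ℝ => 3 * ε * K) (x := 𝓝[>] 0) ?_ ?_
    · have h : Continuous fun ε : ℝ => 3 * ε * K := by fun_prop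
      simpa using (h.tendsto 0).mono_left nhdsWithin_le_nhds
    · filter_upwards [self_mem_nhdsWithin, nhdsWithin_le_nhds (gt_mem_nhds one_pos)] with ε h1 h2
      exact hbound ε h1 h2.le
  have := abs_nonpos_iff.1 hzero
  rw [← Finset.sum_div] at this
  linarith

end Asymptotics
end RootedMetricTree

/-! ### Nonnegative solutions and the ground state -/

theorem eq_zero_of_intervalIntegral_eq_zero {f : ℝ → ℝ} {a b : ℝ} (hab : a < b)
    (hf : ContinuousOn f (Icc a b)) (h0 : ∀ x ∈ Icc a b, 0 ≤ f x) (hi : ∫ x in a..b, f x = 0) :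
    ∀ x ∈ Icc a b, f x = 0 := by
  intro x hx
  by_contra hne
  exact (intervalIntegral.integral_pos hab hf (fun t ht => h0 t (Ioc_subset_Icc_self ht))
    ⟨x, hx, lt_of_le_of_ne (h0 x hx) (Ne.symm hne)⟩).ne' hi

namespace IsSturmLiouvilleSolution

variable {a lam : ℝ} {q y dy : ℝ → ℝ}

/-- The Wronskians of `y` with the fundamental solutions `c` and `s` are constant, hence zero; as
that of `c` with `s` is a nonzero constant, they determine `y` and `dy`. -/
theorem eq_zero_of_initial (ha : 0 ≤ a) (hq : IntegrableOn q (Icc 0 a))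
    (hy : IsSturmLiouvilleSolution a q lam y dy) {x₀ : ℝ} (hx₀ : x₀ ∈ Icc 0 a) (h : y x₀ = 0)
    (h' : dy x₀ = 0) : ∀ x ∈ Icc 0 a, y x = 0 ∧ dy x = 0 := by
  obtain ⟨c, dc, -, -, hc⟩ := exists_isSturmLiouvilleSolution ha hq 1 0
  obtain ⟨s, ds, -, -, hs⟩ := exists_isSturmLiouvilleSolution ha hq 0 1
  obtain ⟨hc, hc0, hdc0⟩ := hc lam
  obtain ⟨hs, hs0, hds0⟩ := hs lam
  have hyc := fun {x} (hx : x ∈ Icc 0 a) => hy.green ha hc hx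
  have hys := fun {x} (hx : x ∈ Icc 0 a) => hy.green ha hs hx
  have hcs := fun {x} (hx : x ∈ Icc 0 a) => hc.green ha hs hx
  simp only [sub_self, zero_mul, intervalIntegral.integral_zero, hc0, hdc0, hs0, hds0, mul_one,
    mul_zero, sub_zero, zero_sub] at hyc hys hcs
  have h1 := hyc hx₀
  have h2 := hys hx₀
  rw [h, h'] at h1 h2
  have h3 : dy 0 = 0 := by linarith
  have h4 : y 0 = 0 := by linarith
  intro x hx
  have e1 := hyc hx
  have e2 := hys hx
  have e3 := hcs hx
  rw [h3] at e1
  rw [h4] at e2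
  constructor
  · linear_combination (-s lam x) * e1 + c lam x * e2 - y x * e3
  · linear_combination (-ds lam x) * e1 + dc lam x * e2 - dy x * e3

theorem deriv_nonneg_left (ha : 0 < a) (hy : IsSturmLiouvilleSolution a q lam y dy)
    (h0 : ∀ x ∈ Icc 0 a, 0 ≤ y x) (h : y 0 = 0) : 0 ≤ dy 0 := by
  have hd := (hy.hasDerivWithinAt 0 (left_mem_Icc.2 ha.le)).mono Ioo_subset_Icc_self
  rw [hasDerivWithinAt_iff_tendsto_slope' (by simp)] at hd
  have := left_nhdsWithin_Ioo_neBot ha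
  refine ge_of_tendsto hd ?_
  filter_upwards [self_mem_nhdsWithin] with x hx
  rw [slope_def_field, h, sub_zero, sub_zero]
  exact div_nonneg (h0 x (Ioo_subset_Icc_self hx)) hx.1.le

theorem deriv_nonpos_right (ha : 0 < a) (hy : IsSturmLiouvilleSolution a q lam y dy)
    (h0 : ∀ x ∈ Icc 0 a, 0 ≤ y x) (h : y a = 0) : dy a ≤ 0 := by
  have hd := (hy.hasDerivWithinAt a (right_mem_Icc.2 ha.le)).mono Ioo_subset_Icc_self
  rw [hasDerivWithinAt_iff_tendsto_slope' (by simp)] at hd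
  have := right_nhdsWithin_Ioo_neBot ha
  refine le_of_tendsto hd ?_
  filter_upwards [self_mem_nhdsWithin] with x hx
  rw [slope_def_field, h, sub_zero]
  exact div_nonpos_of_nonneg_of_nonpos (h0 x (Ioo_subset_Icc_self hx)) (by linarith [hx.2])

theorem deriv_eq_zero_interior (hy : IsSturmLiouvilleSolution a q lam y dy)
    (h0 : ∀ x ∈ Icc 0 a, 0 ≤ y x) {x : ℝ} (hx : x ∈ Ioo 0 a) (h : y x = 0) : dy x = 0 := by
  have hmin : IsLocalMin y x := by
    filter_upwards [Icc_mem_nhds hx.1 hx.2] with t ht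
    rw [h]
    exact h0 t ht
  exact hmin.hasDerivAt_eq_zero (hy.hasDerivAt hx)

end IsSturmLiouvilleSolution

namespace RootedMetricTree

section GroundState

variable {V E : Type*} [DecidableEq V] [Fintype E] {T : RootedMetricTree V E}
  {Q : E → ℝ → ℝ} {lam : ℝ} {y dy : E → ℝ → ℝ} {u : V → ℝ}

variable (T) in
/-- A nonnegative solution on the tree that satisfies the Kirchhoff conditions at all vertices
but the root, where an inequality is required. -/
structure IsRootSupersolution (Q : E → ℝ → ℝ) (lam : ℝ) (u : V → ℝ) (y dy : E → ℝ → ℝ) :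
    Prop where
  solution : ∀ e, IsSturmLiouvilleSolution (T.len e) (Q e) lam (y e) (dy e)
  nonneg : ∀ e, ∀ x ∈ Icc 0 (T.len e), 0 ≤ y e x
  far_eq : ∀ e, y e 0 = u (T.far e)
  near_eq : ∀ e, y e (T.len e) = u (T.near e)
  kirchhoff : ∀ v, v ≠ T.root →
    ∑ e with T.near e = v, dy e (T.len e) = ∑ e with T.far e = v, dy e 0
  root_nonneg : 0 ≤ ∑ e with T.near e = T.root, dy e (T.len e)

/-- A strong minimum principle. Every zero is a double zero: inside an edge it is a minimum, and at
a vertex the one-sided slopes have signs that Kirchhoff's condition, or the inequality at the root,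
allows only if all vanish. Uniqueness then spreads the zero over the connected tree. -/
theorem IsRootSupersolution.pos_or_eq_zero (hQ : ∀ e, IntegrableOn (Q e) (Icc 0 (T.len e)))
    (h : T.IsRootSupersolution Q lam u y dy) :
    (∀ e, ∀ x ∈ Icc 0 (T.len e), 0 < y e x) ∨
      ((∀ v, u v = 0) ∧ ∀ e, ∀ x ∈ Icc 0 (T.len e), y e x = 0 ∧ dy e x = 0) := by
  have h0 : ∀ e, (0 : ℝ) ∈ Icc 0 (T.len e) := fun e => left_mem_Icc.2 (T.len_pos e).le
  have hl : ∀ e, T.len e ∈ Icc 0 (T.len e) := fun e => right_mem_Icc.2 (T.len_pos e).le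
  have hzero : ∀ e, ∀ x ∈ Icc 0 (T.len e), y e x = 0 → dy e x = 0 →
      ∀ x ∈ Icc 0 (T.len e), y e x = 0 ∧ dy e x = 0 := fun e x hx h1 h2 =>
    (h.solution e).eq_zero_of_initial (T.len_pos e).le (hQ e) hx h1 h2
  have hvertex : ∀ v, u v = 0 → (∀ e, T.near e = v → dy e (T.len e) = 0) ∧
      ∀ e, T.far e = v → dy e 0 = 0 := by
    intro v hv
    have h1 : ∀ e ∈ Finset.univ.filter (fun e => T.near e = v), dy e (T.len e) ≤ 0 := by
      intro e he
      refine (h.solution e).deriv_nonpos_right (T.len_pos e) (h.nonneg e) ?_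
      rw [h.near_eq, (Finset.mem_filter.1 he).2, hv]
    have h2 : ∀ e ∈ Finset.univ.filter (fun e => T.far e = v), 0 ≤ dy e 0 := by
      intro e he
      refine (h.solution e).deriv_nonneg_left (T.len_pos e) (h.nonneg e) ?_
      rw [h.far_eq, (Finset.mem_filter.1 he).2, hv]
    have h3 : 0 ≤ ∑ e with T.near e = v, dy e (T.len e) := by
      by_cases hvr : v = T.root
      · rw [hvr]; exact h.root_nonneg
      · rw [h.kirchhoff v hvr]; exact Finset.sum_nonneg h2
    have h4 : ∑ e with T.near e = v, dy e (T.len e) = 0 := le_antisymm (Finset.sum_nonpos h1) h3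
    refine ⟨fun e he => (Finset.sum_eq_zero_iff_of_nonpos h1).1 h4 e (by simp [he]), fun e he => ?_⟩
    have hvr : v ≠ T.root := he ▸ T.far_ne_root e
    rw [h.kirchhoff v hvr] at h4
    exact (Finset.sum_eq_zero_iff_of_nonneg h2).1 h4 e (by simp [he])
  have hnear : ∀ e, u (T.near e) = 0 → ∀ x ∈ Icc 0 (T.len e), y e x = 0 ∧ dy e x = 0 :=
    fun e he => hzero e _ (hl e) (by rw [h.near_eq, he]) ((hvertex _ he).1 e rfl)
  have hfar : ∀ e, u (T.far e) = 0 → ∀ x ∈ Icc 0 (T.len e), y e x = 0 ∧ dy e x = 0 :=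
    fun e he => hzero e _ (h0 e) (by rw [h.far_eq, he]) ((hvertex _ he).2 e rfl)
  have hiff : ∀ v, u v = 0 ↔ u T.root = 0 := by
    refine T.induction_down Iff.rfl fun e he => Iff.trans ⟨fun h1 => ?_, fun h1 => ?_⟩ he
    · rw [← h.near_eq]; exact (hfar e h1 _ (hl e)).1
    · rw [← h.far_eq]; exact (hnear e h1 _ (h0 e)).1
  by_cases hr : u T.root = 0
  · have hu : ∀ v, u v = 0 := fun v => (hiff v).2 hr
    exact Or.inr ⟨hu, fun e => hfar e (hu _)⟩
  · refine Or.inl fun e x hx => lt_of_le_of_ne (h.nonneg e x hx) fun hx0 => hr ?_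
    rw [← hiff (T.far e), ← h.far_eq]
    rcases eq_or_lt_of_le hx.1 with h1 | h1
    · exact (congrArg (y e) h1).trans hx0.symm
    rcases eq_or_lt_of_le hx.2 with h2 | h2
    · rw [h2, h.near_eq] at hx0
      exact (hnear e hx0.symm _ (h0 e)).1
    · exact (hzero e x hx hx0.symm ((h.solution e).deriv_eq_zero_interior (h.nonneg e) ⟨h1, h2⟩
        hx0.symm) _ (h0 e)).1

/-- Equality case of the estimate of the ground state energy by the mean of the potential. -/
theorem IsRootSupersolution.ae_eq_zero [Fintype V]
    (hQ : ∀ e, IntegrableOn (Q e) (Icc 0 (T.len e)))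
    (hsum : ∑ e, ∫ t in (0 : ℝ)..(T.len e), Q e t = 0)
    (h : T.IsRootSupersolution Q 0 u y dy) (hpos : ∀ e, ∀ x ∈ Icc 0 (T.len e), 0 < y e x)
    (hroot : 0 < u T.root) (e : E) :
    ∀ᵐ x ∂(volume.restrict (Icc 0 (T.len e))), Q e x = 0 := by
  have hqi : ∀ e, IntervalIntegrable (Q e) volume 0 (T.len e) := fun e => by
    rw [intervalIntegrable_iff_integrableOn_Icc_of_le (T.len_pos e).le]; exact hQ e
  have hwc : ∀ e, ContinuousOn (fun t => (dy e t / y e t) ^ 2) (Icc 0 (T.len e)) := fun e =>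
    (((h.solution e).continuousOn_deriv (T.len_pos e).le).div (h.solution e).continuousOn
      fun x hx => (hpos e x hx).ne').pow 2
  have hwi : ∀ e, IntervalIntegrable (fun t => (dy e t / y e t) ^ 2) volume 0 (T.len e) := fun e =>
    ContinuousOn.intervalIntegrable (by rw [uIcc_of_le (T.len_pos e).le]; exact hwc e)
  have hric : ∀ e, (∫ t in (0 : ℝ)..(T.len e), Q e t) -
      ∫ t in (0 : ℝ)..(T.len e), (dy e t / y e t) ^ 2 =
      dy e (T.len e) * (u (T.near e))⁻¹ - dy e 0 * (u (T.far e))⁻¹ := by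
    intro e
    have := (h.solution e).riccati (T.len_pos e).le (hpos e)
    simp only [sub_zero] at this
    rw [← intervalIntegral.integral_sub (hqi e) (hwi e), this, h.far_eq, h.near_eq, div_eq_mul_inv,
      div_eq_mul_inv]
  have hnonneg : ∀ e ∈ Finset.univ, 0 ≤ ∫ t in (0 : ℝ)..(T.len e), (dy e t / y e t) ^ 2 := fun e _ =>
    intervalIntegral.integral_nonneg (T.len_pos e).le fun _ _ => sq_nonneg _
  -- In the summed Riccati identity continuity factors out `1 / u v` at each vertex; Kirchhoff's
  -- condition removes all terms but the one at the root, which is nonnegative.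
  have hle : ∑ e, ∫ t in (0 : ℝ)..(T.len e), (dy e t / y e t) ^ 2 ≤ 0 := by
    have h1 := Finset.sum_congr (rfl : (Finset.univ : Finset E) = _) fun e _ => hric e
    rw [Finset.sum_sub_distrib, hsum,
      T.sum_edges_eq_sum_vertices (fun e => dy e (T.len e)) (fun e => dy e 0) fun v => (u v)⁻¹] at h1
    have h2 : 0 ≤ ∑ v, (u v)⁻¹ *
        (∑ e with T.near e = v, dy e (T.len e) - ∑ e with T.far e = v, dy e 0) := by
      refine Finset.sum_nonneg fun v _ => ?_
      by_cases hv : v = T.root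
      · rw [hv, T.filter_far_root, Finset.sum_empty, sub_zero]
        exact mul_nonneg (inv_nonneg.2 hroot.le) h.root_nonneg
      · rw [h.kirchhoff v hv, sub_self, mul_zero]
    linarith
  have hzero := (Finset.sum_eq_zero_iff_of_nonneg hnonneg).1
    (le_antisymm hle (Finset.sum_nonneg hnonneg)) e (Finset.mem_univ e)
  have hw := eq_zero_of_intervalIntegral_eq_zero (T.len_pos e) (hwc e) (fun _ _ => sq_nonneg _) hzero
  have hdy : ∀ x ∈ Icc 0 (T.len e), dy e x = 0 := fun x hx => by
    have := pow_eq_zero_iff (two_ne_zero) |>.1 (hw x hx)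
    exact (div_eq_zero_iff.1 this).resolve_right (hpos e x hx).ne'
  rw [← Measure.restrict_congr_set Ioo_ae_eq_Icc]
  filter_upwards [(h.solution e).ae_hasDerivAt, ae_restrict_mem measurableSet_Ioo] with x hx hxm
  have h1 : HasDerivAt (dy e) 0 x := (hasDerivAt_const x (0 : ℝ)).congr_of_eventuallyEq (by
    filter_upwards [Icc_mem_nhds hxm.1 hxm.2] with t ht using hdy t ht)
  have h2 := hx.2.unique h1
  rw [sub_zero] at h2
  exact (mul_eq_zero.1 h2).resolve_right (hpos e x (Ioo_subset_Icc_self hxm)).ne'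

/-- The boundary terms of the summed energy identity cancel, so `∑ ∫ (y'² - lam y²) = 0` with a
nonnegative integrand that is positive wherever `y ≠ 0`. -/
theorem notMem_neumannSpectrum_zero_of_neg [Fintype V] (hlam : lam < 0) :
    lam ∉ T.neumannSpectrum 0 := by
  rintro ⟨y, dy, hN, e₀, x₀, hx₀, hne⟩
  obtain ⟨u, hu⟩ := hN.continuity
  have hen : ∀ e, ∫ t in (0 : ℝ)..(T.len e), (dy e t ^ 2 + (0 - lam) * y e t ^ 2) =
      dy e (T.len e) * u (T.near e) - dy e 0 * u (T.far e) := fun e => by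
    have := (hN.solution e).energy (T.len_pos e).le
    simp only [Pi.zero_apply] at this
    rw [this, (hu e).1, (hu e).2]
  have hnn : ∀ e t, 0 ≤ dy e t ^ 2 + (0 - lam) * y e t ^ 2 := fun e t =>
    add_nonneg (sq_nonneg _) (mul_nonneg (by linarith) (sq_nonneg _))
  have hnonneg : ∀ e ∈ Finset.univ,
      0 ≤ ∫ t in (0 : ℝ)..(T.len e), (dy e t ^ 2 + (0 - lam) * y e t ^ 2) := fun e _ =>
    intervalIntegral.integral_nonneg (T.len_pos e).le fun t _ => hnn e t
  have hsum : ∑ e, ∫ t in (0 : ℝ)..(T.len e), (dy e t ^ 2 + (0 - lam) * y e t ^ 2) = 0 := by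
    simp_rw [hen]
    rw [T.sum_edges_eq_sum_vertices]
    simp [hN.kirchhoff]
  have hzero := (Finset.sum_eq_zero_iff_of_nonneg hnonneg).1 hsum e₀ (Finset.mem_univ _)
  have h1 := eq_zero_of_intervalIntegral_eq_zero (T.len_pos e₀)
    ((((hN.solution e₀).continuousOn_deriv (T.len_pos e₀).le).pow 2).add
      (continuousOn_const.mul ((hN.solution e₀).continuousOn.pow 2))) (fun t _ => hnn e₀ t) hzero x₀ hx₀
  have h2 : 0 < (0 - lam) * y e₀ x₀ ^ 2 := mul_pos (by linarith) (by positivity)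
  have h3 := sq_nonneg (dy e₀ x₀)
  simp only [Pi.add_apply, Pi.mul_apply, Pi.pow_apply] at h1
  linarith

end GroundState
end RootedMetricTree

/-! ### Continuation of positive supersolutions in the spectral parameter -/

namespace RootedMetricTree

section Continuation

variable {V E : Type*} [DecidableEq V] [Fintype E] (T : RootedMetricTree V E)

/-- Fundamental systems on all edges: `c` and `s` are the solutions with initial data `(1, 0)`
and `(0, 1)`, jointly continuous in the spectral parameter and the position. -/
structure IsFundamentalSystem {V E : Type*} (T : RootedMetricTree V E) (Q : E → ℝ → ℝ)
    (c dc s ds : E → ℝ → ℝ → ℝ) : Prop where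
  continuous_c : ∀ e, Continuous fun z : ℝ × ℝ => c e z.1 z.2
  continuous_dc : ∀ e, Continuous fun z : ℝ × ℝ => dc e z.1 z.2
  continuous_s : ∀ e, Continuous fun z : ℝ × ℝ => s e z.1 z.2
  continuous_ds : ∀ e, Continuous fun z : ℝ × ℝ => ds e z.1 z.2
  solution_c : ∀ e l, IsSturmLiouvilleSolution (T.len e) (Q e) l (c e l) (dc e l)
  solution_s : ∀ e l, IsSturmLiouvilleSolution (T.len e) (Q e) l (s e l) (ds e l)
  c_zero : ∀ e l, c e l 0 = 1
  dc_zero : ∀ e l, dc e l 0 = 0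
  s_zero : ∀ e l, s e l 0 = 0
  ds_zero : ∀ e l, ds e l 0 = 1

theorem exists_isFundamentalSystem {V E : Type*} (T : RootedMetricTree V E) {Q : E → ℝ → ℝ}
    (hQ : ∀ e, IntegrableOn (Q e) (Icc 0 (T.len e))) :
    ∃ c dc s ds, T.IsFundamentalSystem Q c dc s ds := by
  choose c dc hc hdc hcs using fun e =>
    exists_isSturmLiouvilleSolution (T.len_pos e).le (hQ e) 1 0
  choose s ds hs hds hss using fun e =>
    exists_isSturmLiouvilleSolution (T.len_pos e).le (hQ e) 0 1
  exact ⟨c, dc, s, ds, hc, hdc, hs, hds, fun e l => (hcs e l).1, fun e l => (hss e l).1,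
    fun e l => (hcs e l).2.1, fun e l => (hcs e l).2.2, fun e l => (hss e l).2.1,
    fun e l => (hss e l).2.2⟩

/-- Parameters `(l, u, b)` of root supersolutions: `l` is the spectral parameter, `u` are the
vertex values and `b` the derivatives at the far ends of the edges. -/
def rootSupersolutionSet (c dc s ds : E → ℝ → ℝ → ℝ) : Set (ℝ × (V → ℝ) × (E → ℝ)) :=
  {z | (∀ e, ∀ x ∈ Icc 0 (T.len e), 0 ≤ z.2.1 (T.far e) * c e z.1 x + z.2.2 e * s e z.1 x) ∧
    (∀ e, z.2.1 (T.far e) * c e z.1 (T.len e) + z.2.2 e * s e z.1 (T.len e) = z.2.1 (T.near e)) ∧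
    (∀ v, v ≠ T.root → ∑ e with T.near e = v,
      (z.2.1 (T.far e) * dc e z.1 (T.len e) + z.2.2 e * ds e z.1 (T.len e)) =
        ∑ e with T.far e = v, z.2.2 e) ∧
    0 ≤ ∑ e with T.near e = T.root,
      (z.2.1 (T.far e) * dc e z.1 (T.len e) + z.2.2 e * ds e z.1 (T.len e))}

variable {T} {Q : E → ℝ → ℝ} {c dc s ds : E → ℝ → ℝ → ℝ}

theorem IsFundamentalSystem.isRootSupersolution (h : T.IsFundamentalSystem Q c dc s ds)
    {z : ℝ × (V → ℝ) × (E → ℝ)} (hz : z ∈ T.rootSupersolutionSet c dc s ds) :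
    T.IsRootSupersolution Q z.1 z.2.1
      (fun e x => z.2.1 (T.far e) * c e z.1 x + z.2.2 e * s e z.1 x)
      (fun e x => z.2.1 (T.far e) * dc e z.1 x + z.2.2 e * ds e z.1 x) where
  solution e := (h.solution_c e z.1).linear_combination (h.solution_s e z.1) _ _
  nonneg := hz.1
  far_eq e := by simp [h.c_zero, h.s_zero]
  near_eq := hz.2.1
  kirchhoff v hv := by simpa [h.dc_zero, h.ds_zero] using hz.2.2.1 v hv
  root_nonneg := hz.2.2.2

/-- All conditions are equations or non-strict inequalities between continuous functions; strict
positivity would be lost in limits and is recovered by `pos_of_mem`. -/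
theorem IsFundamentalSystem.isClosed_rootSupersolutionSet (h : T.IsFundamentalSystem Q c dc s ds) :
    IsClosed (T.rootSupersolutionSet c dc s ds) := by
  have hev : ∀ {f : ℝ → ℝ → ℝ}, Continuous (fun z : ℝ × ℝ => f z.1 z.2) → ∀ x : ℝ,
      Continuous fun z : ℝ × (V → ℝ) × (E → ℝ) => f z.1 x := fun hf x =>
    hf.comp (continuous_fst.prodMk continuous_const)
  have hc := fun e x => hev (h.continuous_c e) x
  have hdc := fun e x => hev (h.continuous_dc e) x
  have hs := fun e x => hev (h.continuous_s e) x
  have hds := fun e x => hev (h.continuous_ds e) x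
  have hval : ∀ e x, Continuous fun z : ℝ × (V → ℝ) × (E → ℝ) =>
      z.2.1 (T.far e) * c e z.1 x + z.2.2 e * s e z.1 x := by
    intro e x
    exact (((continuous_apply (T.far e)).comp (continuous_fst.comp continuous_snd)).mul
      (hc e x)).add (((continuous_apply e).comp (continuous_snd.comp continuous_snd)).mul (hs e x))
  have hder : ∀ e x, Continuous fun z : ℝ × (V → ℝ) × (E → ℝ) =>
      z.2.1 (T.far e) * dc e z.1 x + z.2.2 e * ds e z.1 x := by
    intro e x
    exact (((continuous_apply (T.far e)).comp (continuous_fst.comp continuous_snd)).mul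
      (hdc e x)).add (((continuous_apply e).comp (continuous_snd.comp continuous_snd)).mul (hds e x))
  have hsum : ∀ v, Continuous fun z : ℝ × (V → ℝ) × (E → ℝ) => ∑ e with T.near e = v,
      (z.2.1 (T.far e) * dc e z.1 (T.len e) + z.2.2 e * ds e z.1 (T.len e)) := fun v =>
    continuous_finsetSum _ fun e _ => hder e _
  refine IsClosed.and ?_ (IsClosed.and ?_ (IsClosed.and ?_ ?_))
  · simp only [ofPred_forall]
    exact isClosed_iInter fun e => isClosed_iInter fun x => isClosed_iInter fun _ =>
      isClosed_le continuous_const (hval e x)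
  · simp only [ofPred_forall]
    exact isClosed_iInter fun e => isClosed_eq (hval e _) (by fun_prop)
  · simp only [ofPred_forall]
    exact isClosed_iInter fun v => isClosed_iInter fun _ => isClosed_eq (hsum v) (by fun_prop)
  · exact isClosed_le continuous_const (hsum _)

theorem IsFundamentalSystem.pos_of_mem (h : T.IsFundamentalSystem Q c dc s ds)
    (hQ : ∀ e, IntegrableOn (Q e) (Icc 0 (T.len e)))
    {z : ℝ × (V → ℝ) × (E → ℝ)} (hz : z ∈ T.rootSupersolutionSet c dc s ds) (hne : z.2 ≠ 0) :
    ∀ e, ∀ x ∈ Icc 0 (T.len e), 0 < z.2.1 (T.far e) * c e z.1 x + z.2.2 e * s e z.1 x := by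
  rcases (h.isRootSupersolution hz).pos_or_eq_zero hQ with h1 | ⟨h1, h2⟩
  · exact h1
  · refine absurd (Prod.ext (funext h1) (funext fun e => ?_)) hne
    have := (h2 e 0 (left_mem_Icc.2 (T.len_pos e).le)).2
    simpa [h.dc_zero, h.ds_zero] using this

theorem smul_mem_rootSupersolutionSet {l : ℝ} {w : (V → ℝ) × (E → ℝ)} {r : ℝ} (hr : 0 ≤ r)
    (hw : (l, w) ∈ T.rootSupersolutionSet c dc s ds) :
    (l, r • w) ∈ T.rootSupersolutionSet c dc s ds := by
  obtain ⟨h1, h2, h3, h4⟩ := hw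
  simp only [rootSupersolutionSet, mem_ofPred_eq, Prod.smul_fst, Prod.smul_snd, Pi.smul_apply,
    smul_eq_mul, mul_assoc, ← mul_add, ← Finset.mul_sum]
  exact ⟨fun e x hx => mul_nonneg hr (h1 e x hx), fun e => by rw [← h2 e],
    fun v hv => by rw [h3 v hv], mul_nonneg hr h4⟩

/-- Positive logarithmic derivative data give a normalized root supersolution. -/
theorem exists_mem_rootSupersolutionSet [Fintype V] {l : ℝ} {m : V → ℝ}
    (hm : ∀ v, m v = ∑ e with T.near e = v, (dc e l (T.len e) + m (T.far e) * ds e l (T.len e)) /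
      (c e l (T.len e) + m (T.far e) * s e l (T.len e)))
    (hpos : ∀ e, ∀ x ∈ Icc 0 (T.len e), 0 < c e l x + m (T.far e) * s e l x)
    (hroot : 0 ≤ m T.root) :
    ∃ w, ‖w‖ = 1 ∧ (l, w) ∈ T.rootSupersolutionSet c dc s ds := by
  have hl : ∀ e, 0 < c e l (T.len e) + m (T.far e) * s e l (T.len e) := fun e =>
    hpos e _ (right_mem_Icc.2 (T.len_pos e).le)
  obtain ⟨u, hu0, huinv, hun, hunear, hufar⟩ := T.exists_vertex_values m
    (fun e => c e l (T.len e)) (fun e => s e l (T.len e)) (fun e => dc e l (T.len e))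
    (fun e => ds e l (T.len e)) (fun e => (hl e).ne') hm
  have hupos : ∀ v, 0 < u v := T.induction_down (by simp [hu0]) fun e he => by
    rw [huinv]
    exact mul_pos (inv_pos.2 (hl e)) he
  set w : (V → ℝ) × (E → ℝ) := (u, fun e => u (T.far e) * m (T.far e)) with hw
  have hmem : (l, w) ∈ T.rootSupersolutionSet c dc s ds := by
    simp only [rootSupersolutionSet, mem_ofPred_eq, hw, mul_assoc, ← mul_add]
    refine ⟨fun e x hx => (mul_pos (hupos _) (hpos e x hx)).le, hun, fun v hv => ?_, ?_⟩
    · rw [hunear v, hufar v hv]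
    · rw [hunear]
      exact mul_nonneg (hupos _).le hroot
  have hne : w ≠ 0 := fun h0 => by
    have : u T.root = 0 := congrFun (congrArg Prod.fst h0) T.root
    rw [hu0] at this
    exact one_ne_zero this
  refine ⟨‖w‖⁻¹ • w, ?_, smul_mem_rootSupersolutionSet (inv_nonneg.2 (norm_nonneg _)) hmem⟩
  rw [norm_smul, norm_inv, norm_norm, inv_mul_cancel₀ (norm_ne_zero_iff.2 hne)]

/-- Openness in the spectral parameter. The logarithmic derivatives, recomputed from the leaves, are
continuous at the given parameter and there reproduce the given solution; positivity on compact
edges and positive flux at the root persist nearby. -/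
theorem IsFundamentalSystem.eventually_exists_mem [Fintype V]
    (h : T.IsFundamentalSystem Q c dc s ds)
    (hQ : ∀ e, IntegrableOn (Q e) (Icc 0 (T.len e)))
    {z : ℝ × (V → ℝ) × (E → ℝ)} (hz : z ∈ T.rootSupersolutionSet c dc s ds) (hne : z.2 ≠ 0)
    (hroot : 0 < z.2.1 T.root)
    (hstrict : 0 < ∑ e with T.near e = T.root,
      (z.2.1 (T.far e) * dc e z.1 (T.len e) + z.2.2 e * ds e z.1 (T.len e))) :
    ∀ᶠ l in 𝓝 z.1, ∃ w, ‖w‖ = 1 ∧ (l, w) ∈ T.rootSupersolutionSet c dc s ds := by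
  obtain ⟨l₀, u, b⟩ := z
  simp only at hroot hstrict hne ⊢
  obtain ⟨m, hm⟩ := T.exists_recursion_up (Λ := ℝ) fun e l r =>
    (dc e l (T.len e) + r * ds e l (T.len e)) / (c e l (T.len e) + r * s e l (T.len e))
  have hpos := h.pos_of_mem hQ hz hne
  simp only at hpos
  have hufar : ∀ e, 0 < u (T.far e) := fun e => by
    simpa [h.c_zero, h.s_zero] using hpos e 0 (left_mem_Icc.2 (T.len_pos e).le)
  have hev : ∀ {f : ℝ → ℝ → ℝ}, Continuous (fun z : ℝ × ℝ => f z.1 z.2) → ∀ x : ℝ,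
      ContinuousAt (fun l => f l x) l₀ := fun hf x =>
    (hf.comp (continuous_id.prodMk continuous_const)).continuousAt
  -- Conditional on the flux identity at the far end, because that identity is proved in the same
  -- leaf-to-root induction that uses this formula for `b`.
  have hb : ∀ e, m (T.far e) l₀ * u (T.far e) = ∑ e' with T.near e' = T.far e,
      (u (T.far e') * dc e' l₀ (T.len e') + b e' * ds e' l₀ (T.len e')) →
      b e = u (T.far e) * m (T.far e) l₀ := by
    intro e he
    have h1 := hz.2.2.1 (T.far e) (T.far_ne_root e)
    simp only [T.filter_far_eq, Finset.sum_singleton] at h1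
    rw [← h1, ← he, mul_comm]
  have hmain : ∀ v, ContinuousAt (m v) l₀ ∧ m v l₀ * u v = ∑ e with T.near e = v,
      (u (T.far e) * dc e l₀ (T.len e) + b e * ds e l₀ (T.len e)) := by
    refine T.induction_up fun v ih => ?_
    have hden : ∀ e, T.near e = v →
        u (T.far e) * (c e l₀ (T.len e) + m (T.far e) l₀ * s e l₀ (T.len e)) = u v := by
      intro e he
      have := hz.2.1 e
      simp only at this
      rw [hb e (ih e he).2, he] at this
      rw [← this]
      ring
    have hden0 : ∀ e, T.near e = v →
        0 < c e l₀ (T.len e) + m (T.far e) l₀ * s e l₀ (T.len e) := by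
      intro e he
      have := hpos e _ (right_mem_Icc.2 (T.len_pos e).le)
      rw [hb e (ih e he).2, mul_assoc, ← mul_add] at this
      exact pos_of_mul_pos_right this (hufar e).le
    constructor
    · rw [show m v = _ from funext (hm v)]
      refine tendsto_finsetSum _ fun e he => ?_
      have he' := (Finset.mem_filter.1 he).2
      exact ((hev (h.continuous_dc e) _).add ((ih e he').1.mul (hev (h.continuous_ds e) _))).div
        ((hev (h.continuous_c e) _).add ((ih e he').1.mul (hev (h.continuous_s e) _)))
        (hden0 e he').ne'
    · rw [hm v, Finset.sum_mul]
      refine Finset.sum_congr rfl fun e he => ?_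
      have he' := (Finset.mem_filter.1 he).2
      rw [hb e (ih e he').2, ← hden e he']
      have := (hden0 e he').ne'
      field_simp
  have hmroot : 0 < m T.root l₀ := by
    have := (hmain T.root).2
    exact pos_of_mul_pos_left (by rw [this]; exact hstrict) hroot.le
  have hevpos : ∀ᶠ l in 𝓝 l₀, ∀ e, ∀ x ∈ Icc 0 (T.len e),
      0 < c e l x + m (T.far e) l * s e l x := by
    refine eventually_all.2 fun e => ?_
    refine isCompact_Icc.eventually_forall_of_forall_eventually fun x hx => ?_
    have hcont : ContinuousAt (fun p : ℝ × ℝ => c e p.1 p.2 + m (T.far e) p.1 * s e p.1 p.2)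
        (l₀, x) :=
      (h.continuous_c e).continuousAt.add ((ContinuousAt.comp (f := Prod.fst) (x := (l₀, x))
        (hmain (T.far e)).1 continuousAt_fst).mul (h.continuous_s e).continuousAt)
    refine hcont.eventually (lt_mem_nhds ?_)
    have := hpos e x hx
    rw [hb e (hmain _).2, mul_assoc, ← mul_add] at this
    exact pos_of_mul_pos_right this (hufar e).le
  filter_upwards [hevpos, (hmain T.root).1.eventually (lt_mem_nhds hmroot)] with l h1 h2
  exact exists_mem_rootSupersolutionSet (fun v => hm v l) h1 h2.le

/-- Below the thresholds of all edges, nonnegative logarithmic derivatives propagate from the leaves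
to the root by `pos_of_le_neg`. -/
theorem IsFundamentalSystem.exists_mem_of_neg [Fintype V] (h : T.IsFundamentalSystem Q c dc s ds)
    (hQ : ∀ e, IntegrableOn (Q e) (Icc 0 (T.len e))) :
    ∃ l ≤ 0, ∃ w, ‖w‖ = 1 ∧ (l, w) ∈ T.rootSupersolutionSet c dc s ds := by
  set B : E → ℝ := fun e => (∫ t in (0 : ℝ)..(T.len e), |Q e t|) / T.len e +
    4 * (∫ t in (0 : ℝ)..(T.len e), |Q e t|) ^ 2 with hB
  have hB0 : ∀ e, 0 ≤ B e := fun e => by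
    have h1 := T.len_pos e
    have h2 : 0 ≤ ∫ t in (0 : ℝ)..(T.len e), |Q e t| :=
      intervalIntegral.integral_nonneg h1.le fun _ _ => abs_nonneg _
    positivity
  set l := -∑ e, B e with hl
  have hle : ∀ e, l ≤ -B e := fun e =>
    neg_le_neg (Finset.single_le_sum (fun e _ => hB0 e) (Finset.mem_univ e))
  obtain ⟨m, hm⟩ := T.exists_recursion_up (Λ := Unit) fun e _ r =>
    (dc e l (T.len e) + r * ds e l (T.len e)) / (c e l (T.len e) + r * s e l (T.len e))
  have hedge : ∀ e, 0 ≤ m (T.far e) () →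
      (∀ x ∈ Icc 0 (T.len e), 0 < c e l x + m (T.far e) () * s e l x) ∧
        0 ≤ dc e l (T.len e) + m (T.far e) () * ds e l (T.len e) := by
    intro e he
    have := ((h.solution_c e l).linear_combination (h.solution_s e l) 1
      (m (T.far e) ())).pos_of_le_neg (T.len_pos e) (hQ e)
      (by simp [h.c_zero, h.s_zero]) (by simpa [h.dc_zero, h.ds_zero] using he) (hle e)
    simpa using this
  have hm0 : ∀ v, 0 ≤ m v () := by
    refine T.induction_up fun v ih => ?_
    rw [hm]
    refine Finset.sum_nonneg fun e he => ?_
    obtain ⟨h1, h2⟩ := hedge e (ih e (Finset.mem_filter.1 he).2)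
    exact div_nonneg h2 (h1 _ (right_mem_Icc.2 (T.len_pos e).le)).le
  exact ⟨l, neg_nonpos.2 (Finset.sum_nonneg fun e _ => hB0 e),
    exists_mem_rootSupersolutionSet (m := fun v => m v ())
    (fun v => hm v ()) (fun e => (hedge e (hm0 _)).1) (hm0 _)⟩

end Continuation
end RootedMetricTree

end

/-! ### Conclusion -/

theorem theorem1p1 {V E : Type*} [Fintype V] [DecidableEq V] [Fintype E]
    (T : RootedMetricTree V E) (Q : E → ℝ → ℝ)
    (hQ : ∀ e, IntegrableOn (Q e) (Icc 0 (T.len e)))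
    (hspec : T.neumannSpectrum Q = T.neumannSpectrum 0) :
    ∀ e, ∀ᵐ x ∂(volume.restrict (Icc 0 (T.len e))), Q e x = 0 := by
  intro e₀
  have : Nonempty E := ⟨e₀⟩
  have hsum := RootedMetricTree.sum_integral_eq_zero_of_neumannSpectrum_eq hQ hspec
  obtain ⟨c, dc, s, ds, h⟩ := T.exists_isFundamentalSystem hQ
  obtain ⟨l₁, hl₁, w₁, hw₁, hz₁⟩ := h.exists_mem_of_neg hQ
  have hcpt : IsCompact (Icc l₁ 0 ×ˢ Metric.sphere 0 1 ∩ T.rootSupersolutionSet c dc s ds) :=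
    (isCompact_Icc.prod (isCompact_sphere _ _)).inter_right h.isClosed_rootSupersolutionSet
  obtain ⟨z, ⟨⟨hzl, hzn⟩, hz⟩, hmax⟩ := hcpt.exists_isMaxOn
    ⟨(l₁, w₁), ⟨left_mem_Icc.2 hl₁, by simpa using hw₁⟩, hz₁⟩ continuous_fst.continuousOn
  have hne : z.2 ≠ 0 := by
    intro h0
    rw [h0] at hzn
    simp at hzn
  have hsup := h.isRootSupersolution hz
  have hpos := h.pos_of_mem hQ hz hne
  have hu : ∀ e, 0 < z.2.1 (T.far e) ∧ 0 < z.2.1 (T.near e) := fun e => by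
    rw [← hsup.far_eq, ← hsup.near_eq]
    exact ⟨hpos e _ (left_mem_Icc.2 (T.len_pos e).le), hpos e _ (right_mem_Icc.2 (T.len_pos e).le)⟩
  have hroot : 0 < z.2.1 T.root := by
    obtain ⟨e, he⟩ := T.exists_near_eq_root
    exact he ▸ (hu e).2
  have hl0 : z.1 = 0 := by
    by_contra hlne
    have hlneg : z.1 < 0 := lt_of_le_of_ne hzl.2 hlne
    -- Zero flux at the root makes the supersolution an eigenfunction with negative eigenvalue;
    -- positive flux permits a larger parameter, against maximality.
    rcases eq_or_lt_of_le hsup.root_nonneg with heq | hlt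
    · refine RootedMetricTree.notMem_neumannSpectrum_zero_of_neg (T := T) hlneg ?_
      rw [← hspec]
      refine ⟨_, _, ⟨hsup.solution, ⟨z.2.1, fun e => ⟨hsup.far_eq e, hsup.near_eq e⟩⟩,
        fun v => ?_⟩, e₀, 0, left_mem_Icc.2 (T.len_pos e₀).le,
        (hpos e₀ 0 (left_mem_Icc.2 (T.len_pos e₀).le)).ne'⟩
      by_cases hv : v = T.root
      · rw [hv, ← heq, T.filter_far_root, Finset.sum_empty]
      · exact hsup.kirchhoff v hv
    · have hev := h.eventually_exists_mem hQ hz hne hroot hlt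
      obtain ⟨l, ⟨w, hw, hlw⟩, hll⟩ :=
        ((hev.filter_mono (nhdsWithin_le_nhds (s := Ioi z.1))).and (Ioo_mem_nhdsGT hlneg)).exists
      have := hmax ⟨⟨⟨hzl.1.trans hll.1.le, hll.2.le⟩, by simpa using hw⟩, hlw⟩
      exact absurd this (not_le.2 hll.1)
  rw [hl0] at hsup
  exact hsup.ae_eq_zero hQ hsum (by simpa only [hl0] using hpos) hroot e₀
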